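/- **Setting.** Let $n\ge 3$, let $U\subseteq\mathbb R^n$ be open and connected with coordinates $u=(u^1,\dots,u^n)$; all functions are smooth on $U$ and $\partial_i=\partial/\partial u^i$. Let $u^i_t=v^i(u)\,u^i_x$, $i=1,\dots,n$, be a strictly hyperbolic system (the $v^i(u)$ are real and pairwise distinct at every $u\in U$). For a non-degenerate diagonal metric $g=(g_{ii})$ write $g^{ii}=1/g_{ii}$, $\Gamma^i_{jk}$ for its Christoffel symbols, $\nabla$ for its Levi-Civita connection, and $R^{ij}_{kl}$ for its curvature tensor ($R^{ij}_{ij}>0$ on a round sphere). Suppose that $g$ is one of the metrics of the system: there are nowhere vanishing functions $f^i(u^i)$ of one variable such that $f^i(u^i)\,g_{ii}(u)$ is a flat metric whose local Hamiltonian operator generates the system, i.e. $v^i\delta^i_k=\nabla_0^i\nabla_{0,k}h$ for some $h$, with $\nabla_0$ the connection of this flat metric (so the system is a DN system). An affinor of $g$ is a family $w^i(u)$ with $\partial_j w^i=\Gamma^i_{ij}\,(w^j-w^i)$ for $i\ne j$. For affinors $w_1,\dots,w_m$ and a constant symmetric matrix $(c_{pq})$ let $$J^{ij}=g^{ii}\Big(\delta^i_j\tfrac{d}{dx}-\Gamma^j_{ik}u^k_x\Big)+\sum_{p,q}c_{pq}\,w_p^i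 u^i_x\Big(\tfrac{d}{dx}\Big)^{-1}w_q^j u^j_x ;$$ $J$ is a Hamiltonian operator of $g$ if $R^{ij}_{kl}=\big(\sum_{p,q} c_{pq}w^i_pw^j_q\big)(\delta^i_k\delta^j_l-\delta^i_l\delta^j_k)$. Here $(d/dx)^{-1}$ of $T(u)_x$ is $T(u)$, up to an additive constant. A density $h$ of a conservation law of the system is a Casimir, momentum, or Hamiltonian density for $J$ if $J^{ij}\partial_jh$ equals $0$, $u^i_x$, or $v^iu^i_x$, respectively. For conservation laws $B_t=A_x$, $N_t=M_x$ (i.e. $\partial_iA=v^i\partial_iB$, $\partial_iM=v^i\partial_iN$) with $BM-AN\neq0$ on $U$, the reciprocal transformation $d\hat x=B\,dx+A\,dt$, $d\hat t=N\,dx+M\,dt$ has the reciprocal metric $$\hat g_{ii}=\Big(\frac{M-Nv^i}{BM-AN}\Big)^2g_{ii}.$$ **Theorem.** (i) Let $d\hat x=B\,dx+A\,dt$, $d\hat t=dt$ be a reciprocal transformation such that $\hat g$ is flat and non-degenerate. Then $g$ is flat, or of constant curvature, or conformally flat; there is an affinor $w$ of $g$ with $R^{ij}_{ij}=w^i+w^j$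 for $i\neq j$, such that the operator with nonlocal part $w^iu^i_x(d/dx)^{-1}u^j_x+u^i_x(d/dx)^{-1}w^ju^j_x$ is a Hamiltonian operator of $g$. For every such Hamiltonian operator $J$, the density $B$ is, up to an additive constant, a linear combination with constant coefficients of Casimir and momentum densities for $J$. If $g$ has constant curvature $K$, the same holds for $J$ with nonlocal part $K\,u^i_x(d/dx)^{-1}u^j_x$; if $g$ is flat, the same holds for $J$ with no nonlocal part. (ii) Let $d\hat x=dx$, $d\hat t=N\,dx+M\,dt$ be a reciprocal transformation such that $\hat g$ is flat and non-degenerate. If $n=3$, suppose moreover that $v^i\not\equiv0$ for $i=1,2,3$. Then there is a (possibly null) affinor $w$ of $g$ with $R^{ij}_{ij}=w^iv^j+w^jv^i$ for $i\ne j$, such that the operator with nonlocal part $w^iu^i_x(d/dx)^{-1}v^ju^j_x+v^iu^i_x(d/dx)^{-1}w^ju^j_x$ is a Hamiltonian operator of $g$. For every such Hamiltonian operator $J$, the density $N$ is, up to an additive constant, a linear combination with constant coefficients of Casimir and Hamiltonian densities for $J$. If $g$ is flat, the same holds for $J$ with no nonlocal part. -/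

import Mathlib

open scoped ContDiff

noncomputable section

namespace Hydro

variable {n m : ℕ}

/-- The partial derivative `∂_i f` in the coordinates `u = (u^1, …, u^n)`. -/
def pd (i : Fin n) (f : (Fin n → ℝ) → ℝ) (u : Fin n → ℝ) : ℝ :=
  fderiv ℝ f u (Pi.single i 1)

/-! ### Diagonal metrics

A diagonal (possibly indefinite) metric is given by its covariant components
`g i = g_{ii}`, functions of `u`. -/

/-- Covariant components `g_{ij}` of the diagonal metric. -/
def lower (g : Fin n → (Fin n → ℝ) → ℝ) (i j : Fin n) (u : Fin n → ℝ) : ℝ :=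
  if i = j then g i u else 0

/-- Contravariant components `g^{ij}` of the diagonal metric. -/
def upper (g : Fin n → (Fin n → ℝ) → ℝ) (i j : Fin n) (u : Fin n → ℝ) : ℝ :=
  if i = j then (g i u)⁻¹ else 0

/-- Christoffel symbols `Γ^i_{jk}` of the Levi-Civita connection. -/
def christoffel (g : Fin n → (Fin n → ℝ) → ℝ) (i j k : Fin n) (u : Fin n → ℝ) : ℝ :=
  (1 / 2) * ∑ s, upper g i s u *
    (pd j (lower g s k) u + pd k (lower g s j) u - pd s (lower g k j) u)

/-- The curvature tensor `R^i_{jkl}`. -/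
def riemann (g : Fin n → (Fin n → ℝ) → ℝ) (i j k l : Fin n) (u : Fin n → ℝ) : ℝ :=
  pd k (christoffel g i l j) u - pd l (christoffel g i k j) u
    + ∑ s, (christoffel g i k s u * christoffel g s l j u
        - christoffel g i l s u * christoffel g s k j u)

/-- The curvature tensor with two indices raised, `R^{ij}_{kl}`; `R^{ij}_{ij}` is the sectional
curvature of the coordinate plane `(i, j)` (positive for a round sphere). -/
def riemannUp (g : Fin n → (Fin n → ℝ) → ℝ) (i j k l : Fin n) (u : Fin n → ℝ) : ℝ :=
  ∑ s, upper g j s u * riemann g i s k l u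

/-- `∇^i ∇_k h`. -/
def hess (g : Fin n → (Fin n → ℝ) → ℝ) (h : (Fin n → ℝ) → ℝ) (i k : Fin n)
    (u : Fin n → ℝ) : ℝ :=
  ∑ s, upper g i s u * (pd s (pd k h) u - ∑ r, christoffel g r s k u * pd r h u)

/-- `g` is a smooth non-degenerate diagonal metric on `U`. -/
def IsMetric (U : Set (Fin n → ℝ)) (g : Fin n → (Fin n → ℝ) → ℝ) : Prop :=
  ∀ i, ContDiffOn ℝ ∞ (g i) U ∧ ∀ u ∈ U, g i u ≠ 0

/-- `g` is a flat non-degenerate metric on `U`. -/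
def IsFlat (U : Set (Fin n → ℝ)) (g : Fin n → (Fin n → ℝ) → ℝ) : Prop :=
  IsMetric U g ∧ ∀ u ∈ U, ∀ i j k l, riemann g i j k l u = 0

/-- `g` is a metric of constant curvature `K` on `U`. -/
def HasConstCurvature (U : Set (Fin n → ℝ)) (g : Fin n → (Fin n → ℝ) → ℝ) (K : ℝ) : Prop :=
  IsMetric U g ∧ ∀ u ∈ U, ∀ i j k l, riemannUp g i j k l u =
    K * ((if i = k ∧ j = l then 1 else 0) - (if i = l ∧ j = k then 1 else 0))

/-- `g` becomes flat after multiplication by a smooth positive function. -/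
def IsConformallyFlat (U : Set (Fin n → ℝ)) (g : Fin n → (Fin n → ℝ) → ℝ) : Prop :=
  IsMetric U g ∧ ∃ lam : (Fin n → ℝ) → ℝ, ContDiffOn ℝ ∞ lam U ∧ (∀ u ∈ U, 0 < lam u) ∧
    IsFlat U (fun i u => lam u * g i u)

/-- `w^1, …, w^n` are the diagonal entries of an affinor of `g`:
`∂_j w^i = Γ^i_{ij} (w^j - w^i)` for `i ≠ j`, where `Γ^i_{ij} = ∂_j ln H_i`, `g_{ii} = H_i ^ 2`. -/
def IsAffinor (U : Set (Fin n → ℝ)) (g w : Fin n → (Fin n → ℝ) → ℝ) : Prop :=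
  (∀ i, ContDiffOn ℝ ∞ (w i) U) ∧
    ∀ u ∈ U, ∀ i j, i ≠ j → pd j (w i) u = christoffel g i i j u * (w j u - w i u)

/-! ### Hamiltonian operators -/

/-- The data of the (in general nonlocal) operator
`J^{ij} = g^{ii} (δ^i_j d/dx - Γ^j_{ik} u^k_x) + ∑_{p,q} c_{pq} w_p^i u^i_x (d/dx)⁻¹ w_q^j u^j_x`.
The form `∑_l ε_l w_l^i u^i_x (d/dx)⁻¹ w_l^j u^j_x`, `ε_l = ± 1`, of the nonlocal part is the case
of a diagonal `c`, to which a symmetric `c` is brought by a constant linear change of the `w_p`. -/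
structure HamOp (n m : ℕ) where
  g : Fin n → (Fin n → ℝ) → ℝ
  w : Fin m → Fin n → (Fin n → ℝ) → ℝ
  c : Matrix (Fin m) (Fin m) ℝ

/-- `J` is a Hamiltonian operator on `U`: `c` is symmetric, the `w_p` are affinors of the metric,
and the curvature is `R^{ij}_{kl} = ∑ c_{pq} w_p^i w_q^j (δ^i_k δ^j_l - δ^i_l δ^j_k)`. -/
def HamOp.IsHamiltonian (U : Set (Fin n → ℝ)) (J : HamOp n m) : Prop :=
  IsMetric U J.g ∧ J.c.IsSymm ∧ (∀ p, IsAffinor U J.g (J.w p)) ∧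
    ∀ u ∈ U, ∀ i j k l, riemannUp J.g i j k l u =
      (∑ p, ∑ q, J.c p q * J.w p i u * J.w q j u) *
        ((if i = k ∧ j = l then 1 else 0) - (if i = l ∧ j = k then 1 else 0))

/-- `J^{ij} ∂_j h = ξ^i u^i_x`. Here `J^{ij} ∂_j h = ∑_k V^i_k(u) u^k_x` with
`V^i_k = ∇^i ∇_k h + δ^i_k ∑ c_{pq} w_p^i T_q`, where `T_q(u) = (d/dx)⁻¹ (∑_j w_q^j ∂_j h u^j_x)`,
that is `∂_j T_q = w_q^j ∂_j h`; the `T_q` are determined up to additive constants. -/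
def HamOp.Generates (U : Set (Fin n → ℝ)) (J : HamOp n m) (h : (Fin n → ℝ) → ℝ)
    (ξ : Fin n → (Fin n → ℝ) → ℝ) : Prop :=
  ∃ T : Fin m → (Fin n → ℝ) → ℝ,
    (∀ q, ContDiffOn ℝ ∞ (T q) U) ∧
    (∀ q, ∀ u ∈ U, ∀ j, pd j (T q) u = J.w q j u * pd j h u) ∧
    ∀ u ∈ U, ∀ i k,
      hess J.g h i k u + (if i = k then ∑ p, ∑ q, J.c p q * J.w p i u * T q u else 0)
        = if i = k then ξ i u else 0

/-- The local operator `g^{ii} (δ^i_j d/dx - Γ^j_{ik} u^k_x)`. -/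
def localOp (g : Fin n → (Fin n → ℝ) → ℝ) : HamOp n 0 where
  g := g
  w := Fin.elim0
  c := 0

/-- The operator with nonlocal part `K u^i_x (d/dx)⁻¹ u^j_x`. -/
def constOp (g : Fin n → (Fin n → ℝ) → ℝ) (K : ℝ) : HamOp n 1 where
  g := g
  w := fun _ _ _ => 1
  c := fun _ _ => K

/-- The operator with nonlocal part
`w^i u^i_x (d/dx)⁻¹ z^j u^j_x + z^i u^i_x (d/dx)⁻¹ w^j u^j_x`. -/
def pairOp (g w z : Fin n → (Fin n → ℝ) → ℝ) : HamOp n 2 where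
  g := g
  w := ![w, z]
  c := !![0, 1; 1, 0]

/-! ### Systems `u^i_t = v^i(u) u^i_x` and their conservation laws -/

/-- `B(u)_t = A(u)_x` on solutions of `u^i_t = v^i(u) u^i_x`: both functions are smooth and
`∂_i A = v^i ∂_i B`. -/
def IsConservationLaw (U : Set (Fin n → ℝ)) (v : Fin n → (Fin n → ℝ) → ℝ)
    (B A : (Fin n → ℝ) → ℝ) : Prop :=
  ContDiffOn ℝ ∞ B U ∧ ContDiffOn ℝ ∞ A U ∧ ∀ u ∈ U, ∀ i, pd i A u = v i u * pd i B u

/-- The system is strictly hyperbolic: the smooth velocities are distinct at every point. -/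
def IsStrictlyHyperbolic (U : Set (Fin n → ℝ)) (v : Fin n → (Fin n → ℝ) → ℝ) : Prop :=
  (∀ i, ContDiffOn ℝ ∞ (v i) U) ∧ ∀ u ∈ U, ∀ i j, i ≠ j → v i u ≠ v j u

/-- The system is generated by the local Hamiltonian operator of the flat metric `g₀`. -/
def IsDNWith (U : Set (Fin n → ℝ)) (v g₀ : Fin n → (Fin n → ℝ) → ℝ) : Prop :=
  IsFlat U g₀ ∧ ∃ h : (Fin n → ℝ) → ℝ, ContDiffOn ℝ ∞ h U ∧ (localOp g₀).Generates U h v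

/-- `g` is one of the metrics associated with the system: `f^i(u^i) g_{ii}` is, for suitable
functions `f^i` of one variable, a flat metric whose local operator generates the system. In
particular the system is then a DN system. -/
def IsMetricOf (U : Set (Fin n → ℝ)) (v g : Fin n → (Fin n → ℝ) → ℝ) : Prop :=
  IsMetric U g ∧ ∃ f : Fin n → ℝ → ℝ,
    (∀ i, ContDiffOn ℝ ∞ (fun u : Fin n → ℝ => f i (u i)) U ∧ ∀ u ∈ U, f i (u i) ≠ 0) ∧
    IsDNWith U v (fun i u => f i (u i) * g i u)

/-- `h` is the density of a conservation law with `J^{ij} ∂_j h = ξ^i u^i_x`. -/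
def IsDensityOf (U : Set (Fin n → ℝ)) (v : Fin n → (Fin n → ℝ) → ℝ) (J : HamOp n m)
    (ξ : Fin n → (Fin n → ℝ) → ℝ) (h : (Fin n → ℝ) → ℝ) : Prop :=
  (∃ a, IsConservationLaw U v h a) ∧ J.Generates U h ξ

/-- Casimir densities: `J^{ij} ∂_j h = 0`. -/
def casimirs (U : Set (Fin n → ℝ)) (v : Fin n → (Fin n → ℝ) → ℝ) (J : HamOp n m) :
    Set ((Fin n → ℝ) → ℝ) :=
  {h | IsDensityOf U v J (fun _ _ => 0) h}

/-- Momentum densities: `J^{ij} ∂_j h = u^i_x`. -/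
def momenta (U : Set (Fin n → ℝ)) (v : Fin n → (Fin n → ℝ) → ℝ) (J : HamOp n m) :
    Set ((Fin n → ℝ) → ℝ) :=
  {h | IsDensityOf U v J (fun _ _ => 1) h}

/-- Hamiltonian densities: `J^{ij} ∂_j h = v^i u^i_x`. -/
def hamiltonians (U : Set (Fin n → ℝ)) (v : Fin n → (Fin n → ℝ) → ℝ) (J : HamOp n m) :
    Set ((Fin n → ℝ) → ℝ) :=
  {h | IsDensityOf U v J v h}

/-- `h` is, up to an additive constant, a linear combination with constant coefficients of
elements of `S`. -/
def IsCombination (S : Set ((Fin n → ℝ) → ℝ)) (h : (Fin n → ℝ) → ℝ) : Prop :=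
  ∃ a : ℝ, (fun u => h u + a) ∈ Submodule.span ℝ S

/-! ### Reciprocal transformations `dx̂ = B dx + A dt`, `dt̂ = N dx + M dt` -/

/-- `B_t = A_x` and `N_t = M_x` are conservation laws with `B M - A N ≠ 0` on `U`. -/
def IsReciprocal (U : Set (Fin n → ℝ)) (v : Fin n → (Fin n → ℝ) → ℝ)
    (B A N M : (Fin n → ℝ) → ℝ) : Prop :=
  IsConservationLaw U v B A ∧ IsConservationLaw U v N M ∧ ∀ u ∈ U, B u * M u - A u * N u ≠ 0

/-- The reciprocal metric `ĝ_{ii} = ((M - N v^i) / (B M - A N))² g_{ii}`. -/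
def recMetric (v : Fin n → (Fin n → ℝ) → ℝ) (B A N M : (Fin n → ℝ) → ℝ)
    (g : Fin n → (Fin n → ℝ) → ℝ) : Fin n → (Fin n → ℝ) → ℝ :=
  fun i u => ((M u - N u * v i u) / (B u * M u - A u * N u)) ^ 2 * g i u

end Hydro

end

/-!
Both parts are one computation. Changing `x` only multiplies `g_{ii}` by `1 / B²`, changing `t`
only by `((M - N v^i) / M)²`. Both factors have the form `(P_i / F)²`, where `∂_i F = z^i ∂_i N` for
an affinor `z` (`z = 1`, `P = 1`, `N = F = B`, respectively `z = v`, `F = M`, `P_i = M - N v^i`) and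
`N` is a density; `RecData` records the few equations that are used.

With `Γ^i_{ij} = ∂_j g_{ii} / (2 g_{ii})` the curvature of a diagonal metric splits into the
obstructions `R^i_{jki}`, which depend on `Γ^i_{ij}`, `i ≠ j`, only and hence vanish for `g` because
they vanish for the flat metric `f^i g_{ii}`, and the sectional curvatures `R^{ij}_{ij}`
(`riemannUp_eq_sect`). Since `v` is an affinor (`IsMetricOf.isAffinor`), a density `N` satisfies
`∇_i ∇_j N = 0` for `i ≠ j` (`isDiagHess_of_conservationLaw`), and its diagonal Hessian
`h^i = ∇^i ∇_i N` obeys `∂_j h^i = Γ^i_{ij} (h^j - h^i) - R^{ij}_{ij} ∂_j N` (`hasPd_hess_self`).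

The sectional curvatures of the reciprocal metric turn out to be proportional to
`R^{ij}_{ij} - w^i z^j - w^j z^i` with `w^i = z^i |∇N|² / (2 F²) - h^i / F`, so its flatness gives the
curvature of `g` (`RecData.sect_eq`), and the equation for `h^i` shows that `w` is an affinor
(`RecData.isAffinor`). The nonlocal terms of the operator are explicit: `F` is a potential for
`z^j ∂_j N` and `-|∇N|² / (2 F)` one for `w^j ∂_j N`, and with these `N` itself is a Casimir
(`RecData.generates_zero`).

An arbitrary Hamiltonian operator of the given form has the same `w`, because an affinor `d` with
`d^i z^j + d^j z^i = 0` for `i ≠ j` vanishes. This is pointwise algebra unless `n = 3`, `z = v` and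
some `v^i` vanishes at the point; then `d^j v^j g_{jj}` depends on `u^j` only, which makes the set
`{v^i = 0, d ≠ 0}` open and closed, and `v^i` would vanish identically
(`isCancellable_of_isStrictlyHyperbolic`). For flat `g` the same uniqueness gives `w = 0`, and in
constant curvature `w = K / 2`; then the potential of `w^j ∂_j N - (K / 2) ∂_j N` is a constant, so
that the operator sends `N` to a constant multiple of `z`: either `N` is a Casimir or a multiple of
`N` is a momentum, respectively a Hamiltonian, density.
-/

namespace Hydro

/-! ### Partial derivatives -/

/-- `f` is differentiable at `u` and `∂_j f = f'` there. -/
structure HasPd {n : ℕ} (j : Fin n) (f : (Fin n → ℝ) → ℝ) (f' : ℝ) (u : Fin n → ℝ) : Prop where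
  diff : DifferentiableAt ℝ f u
  eq : pd j f u = f'

section Pd

variable {n : ℕ} {U : Set (Fin n → ℝ)} {u : Fin n → ℝ} {j : Fin n}
  {f g : (Fin n → ℝ) → ℝ} {f' g' : ℝ}

theorem HasPd.congr_val (hf : HasPd j f f' u) (h : f' = g') : HasPd j f g' u := h ▸ hf

theorem hasPd_const (c : ℝ) : HasPd j (fun _ => c) 0 u :=
  ⟨differentiableAt_const c, by simp [pd]⟩

theorem HasPd.add (hf : HasPd j f f' u) (hg : HasPd j g g' u) :
    HasPd j (fun x => f x + g x) (f' + g') u :=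
  ⟨hf.diff.add hg.diff, by
    rw [← hf.eq, ← hg.eq, pd, fderiv_fun_add hf.diff hg.diff]; rfl⟩

theorem HasPd.neg (hf : HasPd j f f' u) : HasPd j (fun x => -f x) (-f') u :=
  ⟨hf.diff.neg, by rw [← hf.eq, pd, fderiv_fun_neg]; rfl⟩

theorem HasPd.sub (hf : HasPd j f f' u) (hg : HasPd j g g' u) :
    HasPd j (fun x => f x - g x) (f' - g') u :=
  ⟨hf.diff.sub hg.diff, by
    rw [← hf.eq, ← hg.eq, pd, fderiv_fun_sub hf.diff hg.diff]; rfl⟩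

theorem HasPd.mul (hf : HasPd j f f' u) (hg : HasPd j g g' u) :
    HasPd j (fun x => f x * g x) (f' * g u + f u * g') u :=
  ⟨hf.diff.mul hg.diff, by
    rw [← hf.eq, ← hg.eq, pd, fderiv_fun_mul hf.diff hg.diff]
    simp only [pd, add_apply, smul_apply, smul_eq_mul]
    ring⟩

theorem HasPd.const_mul (c : ℝ) (hf : HasPd j f f' u) :
    HasPd j (fun x => c * f x) (c * f') u :=
  ((hasPd_const c).mul hf).congr_val (by ring)

theorem HasPd.sq (hf : HasPd j f f' u) : HasPd j (fun x => f x ^ 2) (2 * f u * f') u := by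
  simp only [pow_two]
  exact (hf.mul hf).congr_val (by ring)

theorem HasPd.inv (hf : HasPd j f f' u) (h0 : f u ≠ 0) :
    HasPd j (fun x => (f x)⁻¹) (-f' / f u ^ 2) u :=
  ⟨hf.diff.inv h0, by
    have h := (hasDerivAt_inv h0).comp_hasFDerivAt u hf.diff.hasFDerivAt
    rw [← hf.eq, pd, show (fun x => (f x)⁻¹) = Inv.inv ∘ f from rfl, h.fderiv]
    simp only [pd, smul_apply, smul_eq_mul]
    ring⟩

theorem HasPd.div (hf : HasPd j f f' u) (hg : HasPd j g g' u) (h0 : g u ≠ 0) :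
    HasPd j (fun x => f x / g x) ((f' * g u - f u * g') / g u ^ 2) u := by
  simp only [div_eq_mul_inv (f _)]
  exact (hf.mul (hg.inv h0)).congr_val (by field_simp; ring)

theorem HasPd.sum {ι : Type*} {s : Finset ι} {F : ι → (Fin n → ℝ) → ℝ} {F' : ι → ℝ}
    (h : ∀ a ∈ s, HasPd j (F a) (F' a) u) :
    HasPd j (fun x => ∑ a ∈ s, F a x) (∑ a ∈ s, F' a) u :=
  ⟨DifferentiableAt.fun_sum fun a ha => (h a ha).diff, by
    rw [pd, fderiv_fun_sum fun a ha => (h a ha).diff, sum_apply]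
    exact Finset.sum_congr rfl fun a ha => (h a ha).eq⟩

theorem pd_congr (hU : IsOpen U) (hu : u ∈ U) (h : ∀ x ∈ U, f x = g x) :
    pd j f u = pd j g u := by
  have : f =ᶠ[nhds u] g := Filter.eventually_of_mem (hU.mem_nhds hu) h
  rw [pd, pd, this.fderiv_eq]

theorem HasPd.congr (hU : IsOpen U) (hu : u ∈ U) (h : ∀ x ∈ U, f x = g x)
    (hf : HasPd j f f' u) : HasPd j g f' u := by
  have : g =ᶠ[nhds u] f := Filter.eventually_of_mem (hU.mem_nhds hu) fun x hx => (h x hx).symm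
  exact ⟨hf.diff.congr_of_eventuallyEq this, (pd_congr hU hu h).symm.trans hf.eq⟩

theorem hasPd (hU : IsOpen U) (hu : u ∈ U) (hf : ContDiffOn ℝ ∞ f U) (j : Fin n) :
    HasPd j f (pd j f u) u :=
  ⟨(hf.contDiffAt (hU.mem_nhds hu)).differentiableAt (by simp), rfl⟩

theorem contDiffOn_pd (hU : IsOpen U) (hf : ContDiffOn ℝ ∞ f U) (j : Fin n) :
    ContDiffOn ℝ ∞ (pd j f) U := by
  have h : ContDiffOn ℝ ∞ (fderiv ℝ f) U := hf.fderiv_of_isOpen hU (by simp)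
  exact h.clm_apply contDiffOn_const

theorem pd_comm (hU : IsOpen U) (hu : u ∈ U) (hf : ContDiffOn ℝ ∞ f U) (i j : Fin n) :
    pd i (pd j f) u = pd j (pd i f) u := by
  have hfu : ContDiffAt ℝ ∞ f u := hf.contDiffAt (hU.mem_nhds hu)
  have hs : IsSymmSndFDerivAt ℝ f u := hfu.isSymmSndFDerivAt
    (by simpa using (WithTop.coe_le_coe.2 le_top : ((2 : ℕ∞) : WithTop ℕ∞) ≤ ∞))
  have hd : DifferentiableAt ℝ (fderiv ℝ f) u :=
    ((hf.fderiv_of_isOpen (m := ∞) hU (by simp)).contDiffAt (hU.mem_nhds hu)).differentiableAt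
      (by simp)
  have key (a b : Fin n) : pd a (pd b f) u
      = fderiv ℝ (fderiv ℝ f) u (Pi.single a 1) (Pi.single b 1) := by
    change fderiv ℝ (fun x => fderiv ℝ f x (Pi.single b 1)) u (Pi.single a 1) = _
    rw [fderiv_clm_apply hd (differentiableAt_const _)]
    simp
  rw [key, key]
  exact hs _ _

theorem fderiv_apply_eq_sum_pd (f : (Fin n → ℝ) → ℝ) (u x : Fin n → ℝ) :
    fderiv ℝ f u x = ∑ j, x j * pd j f u := by
  conv_lhs => rw [pi_eq_sum_univ' x]
  simp only [map_sum, map_smul, smul_eq_mul, pd]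

theorem exists_const_of_pd_eq_zero (hU : IsOpen U) (hUc : IsConnected U)
    (hf : ∀ u ∈ U, ∀ j, HasPd j f 0 u) : ∃ s, ∀ u ∈ U, f u = s := by
  rcases n.eq_zero_or_pos with rfl | hn
  · obtain ⟨p, hp⟩ := hUc.nonempty
    exact ⟨f p, fun u _ => by rw [Subsingleton.elim u p]⟩
  refine hU.exists_is_const_of_fderiv_eq_zero hUc.isPreconnected
    (fun u hu => (hf u hu ⟨0, hn⟩).diff.differentiableWithinAt) fun u hu => ?_
  ext x
  simp [fderiv_apply_eq_sum_pd, (hf u hu _).eq]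

/-- A function on a box all of whose partial derivatives other than `∂_k` vanish depends on `u^k`
only. The balls of the sup norm are boxes. -/
theorem eq_of_pd_eq_zero_of_ne {p x y : Fin n → ℝ} {r : ℝ} {k : Fin n}
    (hf : ∀ u ∈ Metric.ball p r, ∀ j, DifferentiableAt ℝ f u ∧ (j ≠ k → pd j f u = 0))
    (hx : x ∈ Metric.ball p r) (hy : y ∈ Metric.ball p r) (hxy : x k = y k) : f x = f y := by
  have hmem (t : ℝ) (ht : t ∈ Set.Icc (0 : ℝ) 1) : x + t • (y - x) ∈ Metric.ball p r :=
    (convex_ball p r).add_smul_sub_mem hx hy ht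
  have hd (t : ℝ) (ht : t ∈ Set.Icc (0 : ℝ) 1) :
      HasDerivWithinAt (fun t : ℝ => f (x + t • (y - x))) 0 (Set.Icc 0 1) t := by
    have h1 := ((hf _ (hmem t ht) k).1).hasFDerivAt
    have h2 : HasDerivAt (fun t : ℝ => x + t • (y - x)) (y - x) t := by
      simpa using ((hasDerivAt_id t).smul_const (y - x)).const_add x
    have h3 := h1.comp_hasDerivAt t h2
    have h4 : fderiv ℝ f (x + t • (y - x)) (y - x) = 0 := by
      rw [fderiv_apply_eq_sum_pd]
      refine Finset.sum_eq_zero fun j _ => ?_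
      by_cases hj : j = k
      · subst hj; simp [hxy]
      · rw [(hf _ (hmem t ht) j).2 hj, mul_zero]
    rw [h4] at h3
    exact h3.hasDerivWithinAt
  have := (convex_Icc (0 : ℝ) 1).norm_image_sub_le_of_norm_hasDerivWithin_le (C := 0) hd
    (by simp) (Set.left_mem_Icc.2 zero_le_one) (Set.right_mem_Icc.2 zero_le_one)
  simp only [zero_mul, norm_le_zero_iff, sub_eq_zero, zero_smul, one_smul, add_zero,
    add_sub_cancel] at this
  exact this.symm

end Pd

/-! ### Curvature of a diagonal metric -/

section Curvature

variable {n : ℕ} {U : Set (Fin n → ℝ)} {u : Fin n → ℝ} {g : Fin n → (Fin n → ℝ) → ℝ}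
  {i j k l : Fin n}

/-- The symbol `Γ^i_{ij} = ∂_j g_{ii} / (2 g_{ii})` of a diagonal metric; `i = j` is allowed. -/
noncomputable def gam (g : Fin n → (Fin n → ℝ) → ℝ) (i j : Fin n) (u : Fin n → ℝ) : ℝ :=
  pd j (g i) u / (2 * g i u)

/-- For distinct `i, j, k` this is `R^i_{jki}`; its vanishing is the compatibility condition of
the equations `∂_j w^i = Γ^i_{ij} (w^j - w^i)` of affinors. -/
noncomputable def tripleCurv (g : Fin n → (Fin n → ℝ) → ℝ) (i j k : Fin n) (u : Fin n → ℝ) : ℝ :=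
  pd k (gam g i j) u + gam g i k u * gam g i j u - gam g i k u * gam g k j u
    - gam g i j u * gam g j k u

/-- For `i ≠ j` this is the sectional curvature `R^{ij}_{ij}` of a diagonal metric. -/
noncomputable def sect (g : Fin n → (Fin n → ℝ) → ℝ) (i j : Fin n) (u : Fin n → ℝ) : ℝ :=
  -((pd j (gam g i j) u + gam g i j u ^ 2 - gam g i j u * gam g j j u) / g j u)
    - (pd i (gam g j i) u + gam g j i u ^ 2 - gam g j i u * gam g i i u) / g i u
    - ∑ s ∈ ({i, j} : Finset (Fin n))ᶜ, gam g i s u * gam g j s u / g s u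

theorem christoffel_eq (g : Fin n → (Fin n → ℝ) → ℝ) (i j k : Fin n) (u : Fin n → ℝ) :
    christoffel g i j k u = (pd j (lower g i k) u + pd k (lower g i j) u - pd i (lower g k j) u)
      / (2 * g i u) := by
  simp only [christoffel, upper, ite_mul, zero_mul, Finset.sum_ite_eq, Finset.mem_univ, if_true]
  field_simp

theorem pd_lower_self : pd k (lower g i i) u = pd k (g i) u := by
  congr 1
  ext x
  simp [lower]

theorem pd_lower_of_ne (h : i ≠ j) : pd k (lower g i j) u = 0 := by
  have : lower g i j = fun _ => 0 := by
    ext x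
    simp [lower, h]
  rw [this, (hasPd_const 0).eq]

theorem christoffel_left : christoffel g i i j u = gam g i j u := by
  rw [christoffel_eq, gam, pd_lower_self]
  by_cases h : i = j
  · subst h; simp [pd_lower_self]
  · simp [pd_lower_of_ne h, pd_lower_of_ne (Ne.symm h)]

theorem christoffel_right : christoffel g i j i u = gam g i j u := by
  rw [christoffel_eq, gam, pd_lower_self]
  by_cases h : i = j
  · subst h; simp [pd_lower_self]
  · simp [pd_lower_of_ne h]

theorem christoffel_diag (h : i ≠ j) :
    christoffel g i j j u = -(pd i (g j) u / (2 * g i u)) := by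
  rw [christoffel_eq, pd_lower_self, pd_lower_of_ne h]
  ring

theorem christoffel_diag' (h : i ≠ j) (hj : g j u ≠ 0) :
    christoffel g i j j u = -(g j u * gam g j i u / g i u) := by
  rw [christoffel_diag h, gam]
  field_simp

theorem christoffel_zero (h1 : i ≠ j) (h2 : i ≠ k) (h3 : j ≠ k) : christoffel g i j k u = 0 := by
  simp [christoffel_eq, pd_lower_of_ne h1, pd_lower_of_ne h2, pd_lower_of_ne h3.symm]

theorem IsMetric.contDiffOn_gam (hg : IsMetric U g) (hU : IsOpen U) (i j : Fin n) :
    ContDiffOn ℝ ∞ (gam g i j) U :=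
  (contDiffOn_pd hU (hg i).1 j).div (contDiffOn_const.mul (hg i).1)
    fun u hu => mul_ne_zero two_ne_zero ((hg i).2 u hu)

theorem IsMetric.pd_eq (hg : IsMetric U g) (hu : u ∈ U) (i j : Fin n) :
    pd j (g i) u = 2 * g i u * gam g i j u := by
  have := (hg i).2 u hu
  rw [gam]
  field_simp

/-- `Γ^i_{ij}` is the logarithmic derivative `∂_j ln |g_{ii}|^{1/2}`. -/
theorem IsMetric.pd_gam_comm (hg : IsMetric U g) (hU : IsOpen U) (hu : u ∈ U) (i j k : Fin n) :
    pd k (gam g i j) u = pd j (gam g i k) u := by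
  have h (j k : Fin n) := ((hasPd hU hu (contDiffOn_pd hU (hg i).1 j) k).div
    ((hasPd hU hu (hg i).1 k).const_mul 2) (mul_ne_zero two_ne_zero ((hg i).2 u hu))).eq
  change pd k (fun x => pd j (g i) x / (2 * g i x)) u = pd j (fun x => pd k (g i) x / (2 * g i x)) u
  rw [h, h, pd_comm hU hu (hg i).1 j k]
  ring

theorem IsMetric.hasPd_christoffel_diag (hg : IsMetric U g) (hU : IsOpen U) (hu : u ∈ U)
    (hij : i ≠ j) (k : Fin n) :
    HasPd k (christoffel g i j j)
      (-(g j u / g i u * (pd k (gam g j i) u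
        + 2 * (gam g j k u - gam g i k u) * gam g j i u))) u := by
  refine HasPd.congr (f := fun x => -(g j x * gam g j i x / g i x)) hU hu
    (fun x hx => (christoffel_diag' hij ((hg j).2 x hx)).symm) ?_
  have hi := (hg i).2 u hu
  refine ((((hasPd hU hu (hg j).1 k).mul (hasPd hU hu (hg.contDiffOn_gam hU j i) k)).div
    (hasPd hU hu (hg i).1 k) hi).neg).congr_val ?_
  rw [hg.pd_eq hu, hg.pd_eq hu]
  field_simp
  ring

theorem riemann_antisymm : riemann g i j k l u = -riemann g i j l k u := by
  simp only [riemann, Finset.sum_sub_distrib]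
  ring

theorem riemann_triple (hij : i ≠ j) (hik : i ≠ k) (hjk : j ≠ k) :
    riemann g i j k i u = tripleCurv g i j k u := by
  have h1 : christoffel g i i j = gam g i j := funext fun x => christoffel_left
  have h2 : christoffel g i k j = fun _ => 0 :=
    funext fun x => christoffel_zero hik hij hjk.symm
  rw [riemann, h1, h2, (hasPd_const 0).eq, tripleCurv]
  rw [← Finset.sum_subset (Finset.subset_univ {i, j, k})]
  · rw [Finset.sum_insert (by simp [hij, hik]), Finset.sum_pair hjk]
    simp only [christoffel_left, christoffel_right, christoffel_zero hik hij hjk.symm,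
      christoffel_zero hik.symm hjk.symm hij]
    ring
  · intro s _ hs
    simp only [Finset.mem_insert, Finset.mem_singleton, not_or] at hs
    obtain ⟨hsi, hsj, hsk⟩ := hs
    rw [christoffel_zero hik (Ne.symm hsi) (Ne.symm hsk),
      christoffel_zero hsk hsj hjk.symm]
    ring

theorem riemann_triple' (hg : IsMetric U g) (hU : IsOpen U) (hu : u ∈ U)
    (hij : i ≠ j) (hik : i ≠ k) (hjk : j ≠ k) :
    riemann g i j k j u = -(g j u / g i u) * tripleCurv g j i k u := by
  have h2 : christoffel g i k j = fun _ => 0 :=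
    funext fun x => christoffel_zero hik hij hjk.symm
  have hi := (hg i).2 u hu
  have hj := (hg j).2 u hu
  have hk := (hg k).2 u hu
  rw [riemann, (hg.hasPd_christoffel_diag hU hu hij k).eq, h2, (hasPd_const 0).eq, tripleCurv]
  rw [← Finset.sum_subset (Finset.subset_univ {i, j, k})]
  · rw [Finset.sum_insert (by simp [hij, hik]), Finset.sum_pair hjk]
    simp only [christoffel_left, christoffel_right, christoffel_zero hik hij hjk.symm,
      christoffel_zero hij hik hjk, christoffel_diag' hij hj, christoffel_diag' hik hk,
      christoffel_diag' hjk.symm hj]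
    field_simp
    ring
  · intro s _ hs
    simp only [Finset.mem_insert, Finset.mem_singleton, not_or] at hs
    obtain ⟨hsi, hsj, hsk⟩ := hs
    rw [christoffel_zero hik (Ne.symm hsi) (Ne.symm hsk), christoffel_zero hij (Ne.symm hsi)
      (Ne.symm hsj)]
    ring

theorem riemann_zero (hij : i ≠ j) (hik : i ≠ k) (hil : i ≠ l) (hjk : j ≠ k) (hjl : j ≠ l)
    (hkl : k ≠ l) : riemann g i j k l u = 0 := by
  have h1 : christoffel g i l j = fun _ => 0 :=
    funext fun x => christoffel_zero hil hij hjl.symm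
  have h2 : christoffel g i k j = fun _ => 0 :=
    funext fun x => christoffel_zero hik hij hjk.symm
  have h3 {k l : Fin n} (hik : i ≠ k) (hil : i ≠ l) (hjk : j ≠ k) (hjl : j ≠ l) (hkl : k ≠ l)
      (s : Fin n) : christoffel g i k s u * christoffel g s l j u = 0 := by
    by_cases hsi : i = s
    · subst hsi; rw [christoffel_zero hil hij hjl.symm, mul_zero]
    by_cases hsk : k = s
    · subst hsk; rw [christoffel_zero hkl hjk.symm hjl.symm, mul_zero]
    · rw [christoffel_zero hik hsi hsk, zero_mul]
  rw [riemann, h1, h2, (hasPd_const 0).eq, (hasPd_const 0).eq]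
  simp [h3 hik hil hjk hjl hkl, h3 hil hik hjl hjk hkl.symm]

theorem riemann_self (hg : IsMetric U g) (hU : IsOpen U) (hu : u ∈ U) (hkl : k ≠ l) :
    riemann g i i k l u = 0 := by
  have h1 (l : Fin n) : christoffel g i l i = gam g i l := funext fun x => christoffel_right
  rw [riemann, h1, h1, hg.pd_gam_comm hU hu i l k, sub_self, zero_add]
  refine Finset.sum_eq_zero fun s _ => ?_
  have hk := (hg k).2 u hu
  have hl := (hg l).2 u hu
  by_cases hsi : s = i
  · subst hsi; simp only [christoffel_right]; ring
  have hi := (hg i).2 u hu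
  have h2 {k l : Fin n} (hkl : k ≠ l) (hk : g k u ≠ 0) (hik : k ≠ i) :
      christoffel g i k k u * christoffel g k l i u
        - christoffel g i l k u * christoffel g k k i u = 0 := by
    by_cases hil : l = i
    · subst hil
      rw [christoffel_left, christoffel_left, christoffel_diag' hik hi,
        christoffel_diag' hik.symm hk]
      field_simp
      ring
    · rw [christoffel_zero hkl hik hil, christoffel_zero (Ne.symm hil) hik.symm hkl.symm]
      ring
  by_cases hsk : s = k
  · subst hsk; exact h2 hkl hk hsi
  by_cases hsl : s = l
  · subst hsl; linarith [h2 hkl.symm hl hsi]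
  have h3 {k l : Fin n} (hkl : k ≠ l) (hsk : s ≠ k) (hsl : s ≠ l) :
      christoffel g i k s u * christoffel g s l i u = 0 := by
    by_cases hil : l = i
    · subst hil
      rw [christoffel_zero hkl.symm (Ne.symm hsi) hsk.symm, zero_mul]
    · rw [christoffel_zero hsl hsi hil, mul_zero]
  rw [h3 hkl hsk hsl, h3 hkl.symm hsl hsk, sub_zero]

theorem sum_eq_add_add_sum_compl (hij : i ≠ j) (F : Fin n → ℝ) :
    ∑ s, F s = F i + F j + ∑ s ∈ ({i, j} : Finset (Fin n))ᶜ, F s := by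
  rw [← Finset.sum_add_sum_compl {i, j}, Finset.sum_pair hij]

theorem riemann_sect (hg : IsMetric U g) (hU : IsOpen U) (hu : u ∈ U) (hij : i ≠ j) :
    riemann g i j i j u = g j u * sect g i j u := by
  have h1 : christoffel g i i j = gam g i j := funext fun x => christoffel_left
  have hi := (hg i).2 u hu
  have hj := (hg j).2 u hu
  have h3 : ∑ s ∈ ({i, j} : Finset (Fin n))ᶜ,
      (christoffel g i i s u * christoffel g s j j u - christoffel g i j s u * christoffel g s i j u)
      = -g j u * ∑ s ∈ ({i, j} : Finset (Fin n))ᶜ, gam g i s u * gam g j s u / g s u := by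
    rw [Finset.mul_sum]
    refine Finset.sum_congr rfl fun s hs => ?_
    simp only [Finset.mem_compl, Finset.mem_insert, Finset.mem_singleton, not_or] at hs
    rw [christoffel_zero hs.1 hs.2 hij, christoffel_left, christoffel_diag' hs.2 hj]
    ring
  rw [riemann, (hg.hasPd_christoffel_diag hU hu hij i).eq, h1,
    sum_eq_add_add_sum_compl hij, h3, sect]
  simp only [christoffel_left, christoffel_right, christoffel_diag' hij hj]
  field_simp
  ring

theorem riemannUp_eq : riemannUp g i j k l u = (g j u)⁻¹ * riemann g i j k l u := by
  simp [riemannUp, upper]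

theorem riemannUp_sect (hg : IsMetric U g) (hU : IsOpen U) (hu : u ∈ U) (hij : i ≠ j) :
    riemannUp g i j i j u = sect g i j u := by
  rw [riemannUp_eq, riemann_sect hg hU hu hij, inv_mul_cancel_left₀ ((hg j).2 u hu)]

/-- The compatibility of the affinor equations makes the curvature operator diagonal in the
coordinate bivectors. -/
theorem riemannUp_eq_sect (hg : IsMetric U g) (hU : IsOpen U) (hu : u ∈ U)
    (hS : ∀ i j k, i ≠ j → i ≠ k → j ≠ k → tripleCurv g i j k u = 0) (i j k l : Fin n) :
    riemannUp g i j k l u = sect g i j u *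
      ((if i = k ∧ j = l then 1 else 0) - (if i = l ∧ j = k then 1 else 0)) := by
  by_cases hkl : k = l
  · subst hkl
    have : riemann g i j k k u = 0 := by simp [riemann]
    rw [riemannUp_eq, this]
    simp
  by_cases hij : i = j
  · subst hij
    rw [riemannUp_eq, riemann_self hg hU hu hkl]
    have h1 : ¬(i = k ∧ i = l) := fun h => hkl (h.1.symm.trans h.2)
    have h2 : ¬(i = l ∧ i = k) := fun h => hkl (h.2.symm.trans h.1)
    simp [h1, h2]
  by_cases hik : i = k
  · subst hik
    by_cases hjl : j = l
    · subst hjl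
      rw [riemannUp_sect hg hU hu hij]
      simp [hij]
    · rw [riemannUp_eq, riemann_antisymm, riemann_triple hij hkl hjl, hS i j l hij hkl hjl]
      simp [hjl, hkl]
  by_cases hjk : j = k
  · subst hjk
    by_cases hil : i = l
    · subst hil
      rw [riemannUp_eq, riemann_antisymm, mul_neg, ← riemannUp_eq, riemannUp_sect hg hU hu hij]
      simp [hij]
    · rw [riemannUp_eq, riemann_antisymm, riemann_triple' hg hU hu hij hil hkl,
        hS j i l (Ne.symm hij) hkl hil]
      simp [hij, hil]
  by_cases hil : i = l
  · subst hil
    rw [riemannUp_eq, riemann_triple hij hik hjk, hS i j k hij hik hjk]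
    simp [hik, hjk]
  by_cases hjl : j = l
  · subst hjl
    rw [riemannUp_eq, riemann_triple' hg hU hu hij hik hjk, hS j i k (Ne.symm hij) hjk hik]
    simp [hik, hjk]
  · rw [riemannUp_eq, riemann_zero hij hik hil hjk hjl hkl]
    simp [hik, hjk]

theorem IsFlat.sect_eq_zero (hg : IsFlat U g) (hU : IsOpen U) (hu : u ∈ U) (hij : i ≠ j) :
    sect g i j u = 0 := by
  rw [← riemannUp_sect hg.1 hU hu hij, riemannUp_eq, hg.2 u hu, mul_zero]

theorem IsFlat.tripleCurv_eq_zero (hg : IsFlat U g) (hu : u ∈ U)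
    (hij : i ≠ j) (hik : i ≠ k) (hjk : j ≠ k) : tripleCurv g i j k u = 0 := by
  rw [← riemann_triple hij hik hjk, hg.2 u hu]

end Curvature

/-! ### Densities with diagonal Hessian -/

section Hessian

variable {n : ℕ} {U : Set (Fin n → ℝ)} {u : Fin n → ℝ} {g : Fin n → (Fin n → ℝ) → ℝ}
  {N : (Fin n → ℝ) → ℝ} {i j k : Fin n}

theorem sum_compl_singleton_eq (hij : i ≠ j) (F : Fin n → ℝ) :
    ∑ s ∈ ({i} : Finset (Fin n))ᶜ, F s = F j + ∑ s ∈ ({i, j} : Finset (Fin n))ᶜ, F s := by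
  have h1 := sum_eq_add_add_sum_compl hij F
  have h2 := Finset.sum_add_sum_compl {i} F
  rw [Finset.sum_singleton] at h2
  linarith

theorem hess_self (hg : IsMetric U g) (hu : u ∈ U) (N : (Fin n → ℝ) → ℝ) (i : Fin n) :
    hess g N i i u = (pd i (pd i N) u - gam g i i u * pd i N u) / g i u
      + ∑ r ∈ ({i} : Finset (Fin n))ᶜ, gam g i r u * pd r N u / g r u := by
  have hi := (hg i).2 u hu
  simp only [hess, upper, ite_mul, zero_mul, Finset.sum_ite_eq, Finset.mem_univ, if_true]
  rw [← Finset.sum_add_sum_compl {i}, Finset.sum_singleton, christoffel_left]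
  have : ∑ r ∈ ({i} : Finset (Fin n))ᶜ, christoffel g r i i u * pd r N u
      = -g i u * ∑ r ∈ ({i} : Finset (Fin n))ᶜ, gam g i r u * pd r N u / g r u := by
    rw [Finset.mul_sum]
    refine Finset.sum_congr rfl fun r hr => ?_
    rw [christoffel_diag' (by simpa using hr) hi]
    ring
  rw [this]
  field_simp
  ring

theorem hess_of_ne (hij : i ≠ j) (N : (Fin n → ℝ) → ℝ) :
    hess g N i j u = (pd i (pd j N) u - gam g i j u * pd i N u - gam g j i u * pd j N u)
      / g i u := by
  simp only [hess, upper, ite_mul, zero_mul, Finset.sum_ite_eq, Finset.mem_univ, if_true]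
  rw [sum_eq_add_add_sum_compl hij, christoffel_left, christoffel_right, Finset.sum_eq_zero]
  · ring
  · intro s hs
    simp only [Finset.mem_compl, Finset.mem_insert, Finset.mem_singleton, not_or] at hs
    rw [christoffel_zero hs.1 hs.2 hij, zero_mul]

/-- `∇_i ∇_j N = 0` on `U` for `i ≠ j`. -/
def IsDiagHess (U : Set (Fin n → ℝ)) (g : Fin n → (Fin n → ℝ) → ℝ) (N : (Fin n → ℝ) → ℝ) : Prop :=
  ∀ u ∈ U, ∀ i j, i ≠ j →
    pd i (pd j N) u = gam g i j u * pd i N u + gam g j i u * pd j N u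

theorem IsDiagHess.hess_of_ne (hN : IsDiagHess U g N) (hu : u ∈ U) (hij : i ≠ j) :
    hess g N i j u = 0 := by
  rw [Hydro.hess_of_ne hij, hN u hu i j hij]
  ring

theorem contDiffOn_hess_self (hU : IsOpen U) (hg : IsMetric U g) (hN : ContDiffOn ℝ ∞ N U)
    (i : Fin n) : ContDiffOn ℝ ∞ (hess g N i i) U := by
  refine ContDiffOn.congr ?_ fun u hu => hess_self hg hu N i
  have h1 := contDiffOn_pd hU hN
  refine (((contDiffOn_pd hU (h1 i) i).sub ((hg.contDiffOn_gam hU i i).mul (h1 i))).div (hg i).1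
    (hg i).2).add (ContDiffOn.sum fun r _ => ?_)
  exact ((hg.contDiffOn_gam hU i r).mul (h1 r)).div (hg r).1 (hg r).2

/-- The square `|∇N|²` of the gradient. -/
noncomputable def gradSq (g : Fin n → (Fin n → ℝ) → ℝ) (N : (Fin n → ℝ) → ℝ) (u : Fin n → ℝ) : ℝ :=
  ∑ r, pd r N u ^ 2 / g r u

theorem contDiffOn_gradSq (hU : IsOpen U) (hg : IsMetric U g) (hN : ContDiffOn ℝ ∞ N U) :
    ContDiffOn ℝ ∞ (gradSq g N) U :=
  ContDiffOn.sum fun r _ => ((contDiffOn_pd hU hN r).pow 2).div (hg r).1 (hg r).2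

theorem hasPd_gradSq (hU : IsOpen U) (hg : IsMetric U g) (hN : ContDiffOn ℝ ∞ N U)
    (hd : IsDiagHess U g N) (hu : u ∈ U) (j : Fin n) :
    HasPd j (gradSq g N) (2 * hess g N j j u * pd j N u) u := by
  have h0 (r : Fin n) := (hg r).2 u hu
  refine (HasPd.sum fun r _ => ((hasPd hU hu (contDiffOn_pd hU hN r) j).sq.div
    (hasPd hU hu (hg r).1 j) (h0 r))).congr_val ?_
  rw [← Finset.sum_add_sum_compl {j}, Finset.sum_singleton, hess_self hg hu]
  have : ∑ r ∈ ({j} : Finset (Fin n))ᶜ, (2 * pd r N u * pd j (pd r N) u * g r u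
      - pd r N u ^ 2 * pd j (g r) u) / g r u ^ 2
      = 2 * pd j N u * ∑ r ∈ ({j} : Finset (Fin n))ᶜ, gam g j r u * pd r N u / g r u := by
    rw [Finset.mul_sum]
    refine Finset.sum_congr rfl fun r hr => ?_
    have := h0 r
    rw [hg.pd_eq hu, hd u hu j r (by simpa [eq_comm] using hr)]
    field_simp
    ring
  rw [this, hg.pd_eq hu]
  have := h0 j
  field_simp

/-- The Codazzi-type commutation `∇_j ∇^i ∇_i N - ∇_i ∇^i ∇_j N = -R^{ij}_{ij} ∂_j N`. -/
theorem hasPd_hess_self (hU : IsOpen U) (hg : IsMetric U g) (hN : ContDiffOn ℝ ∞ N U)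
    (hd : IsDiagHess U g N) (hu : u ∈ U)
    (hS : ∀ i j k, i ≠ j → i ≠ k → j ≠ k → tripleCurv g i j k u = 0) (hij : i ≠ j) :
    HasPd j (hess g N i i)
      (gam g i j u * (hess g N j j u - hess g N i i u) - sect g i j u * pd j N u) u := by
  have h0 (r : Fin n) := (hg r).2 u hu
  have hN1 := contDiffOn_pd hU hN
  have hN2 (r : Fin n) := contDiffOn_pd hU (hN1 r)
  have hγ := hg.contDiffOn_gam hU
  refine HasPd.congr hU hu (fun x hx => (hess_self hg hx N i).symm) ?_
  refine ((((hasPd hU hu (hN2 i i) j).sub ((hasPd hU hu (hγ i i) j).mul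
    (hasPd hU hu (hN1 i) j))).div (hasPd hU hu (hg i).1 j) (h0 i)).add
    (HasPd.sum fun r _ => ((hasPd hU hu (hγ i r) j).mul (hasPd hU hu (hN1 r) j)).div
    (hasPd hU hu (hg r).1 j) (h0 r))).congr_val ?_
  -- Third derivatives are eliminated by differentiating `∇_i ∇_j N = 0`.
  have hthird : pd j (pd i (pd i N)) u = pd i (gam g j i) u * pd j N u
      + gam g j i u * pd i (pd j N) u
      + (pd i (gam g i j) u * pd i N u + gam g i j u * pd i (pd i N) u) := by
    rw [pd_comm hU hu (hN1 i) j i]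
    rw [pd_congr hU hu (fun x hx => hd x hx j i hij.symm)]
    exact (((hasPd hU hu (hγ j i) i).mul (hasPd hU hu (hN1 j) i)).add
      ((hasPd hU hu (hγ i j) i).mul (hasPd hU hu (hN1 i) i))).eq
  have hsum : ∑ r ∈ ({i, j} : Finset (Fin n))ᶜ, ((pd j (gam g i r) u * pd r N u
        + gam g i r u * pd j (pd r N) u) * g r u - gam g i r u * pd r N u * pd j (g r) u)
        / g r u ^ 2
      = gam g i j u * ∑ r ∈ ({i, j} : Finset (Fin n))ᶜ, gam g j r u * pd r N u / g r u
        - gam g i j u * ∑ r ∈ ({i, j} : Finset (Fin n))ᶜ, gam g i r u * pd r N u / g r u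
        + pd j N u * ∑ r ∈ ({i, j} : Finset (Fin n))ᶜ, gam g i r u * gam g j r u / g r u := by
    simp only [Finset.mul_sum]
    rw [← Finset.sum_sub_distrib, ← Finset.sum_add_distrib]
    refine Finset.sum_congr rfl fun r hr => ?_
    simp only [Finset.mem_compl, Finset.mem_insert, Finset.mem_singleton, not_or] at hr
    have hr0 := h0 r
    have hT := hS i r j (Ne.symm hr.1) hij hr.2
    rw [tripleCurv] at hT
    have hT' : pd j (gam g i r) u = gam g i j u * gam g j r u + gam g i r u * gam g r j u
        - gam g i j u * gam g i r u := by linarith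
    rw [hg.pd_eq hu, hd u hu j r (Ne.symm hr.2), hT']
    field_simp
    ring
  rw [sum_compl_singleton_eq hij, hsum, hthird, hess_self hg hu, hess_self hg hu,
    sum_compl_singleton_eq hij, sum_compl_singleton_eq hij.symm, Finset.pair_comm j i, sect,
    hg.pd_eq hu, hg.pd_eq hu, hg.pd_gam_comm hU hu i i j, hd u hu i j hij, hd u hu j i hij.symm]
  have hi := h0 i
  have hj := h0 j
  field_simp
  ring

/-- The densities of a semi-Hamiltonian system with distinct velocities have diagonal Hessian. -/
theorem isDiagHess_of_conservationLaw {v : Fin n → (Fin n → ℝ) → ℝ} {A : (Fin n → ℝ) → ℝ}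
    (hU : IsOpen U) (hv : IsStrictlyHyperbolic U v) (hva : IsAffinor U g v)
    (hN : IsConservationLaw U v N A) : IsDiagHess U g N := by
  intro u hu i j hij
  obtain ⟨hNs, hAs, hA⟩ := hN
  have hd (i j : Fin n) : pd j (pd i A) u = pd j (v i) u * pd i N u + v i u * pd j (pd i N) u := by
    rw [pd_congr hU hu fun x hx => hA x hx i]
    exact ((hasPd hU hu (hva.1 i) j).mul (hasPd hU hu (contDiffOn_pd hU hNs i) j)).eq
  have h := pd_comm hU hu hAs i j
  rw [hd, hd, pd_comm hU hu hNs j i, hva.2 u hu i j hij, hva.2 u hu j i hij.symm,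
    christoffel_left, christoffel_left] at h
  have hne : v j u - v i u ≠ 0 := sub_ne_zero.2 (hv.2 u hu j i hij.symm)
  apply mul_left_cancel₀ hne
  linear_combination h

end Hessian

/-! ### The affinor attached to a reciprocal transformation -/

section Reciprocal

variable {n : ℕ} {U : Set (Fin n → ℝ)} {u : Fin n → ℝ} {g z P : Fin n → (Fin n → ℝ) → ℝ}
  {N F : (Fin n → ℝ) → ℝ} {i j k : Fin n}

/-- The common shape of the two kinds of reciprocal transformations: `g` is turned into
`(P_i / F)² g_{ii}`. Changing `x` only is the case `z = 1`, `P = 1`, `N = F = B`; changing `t` only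
is the case `z = v`, `F = M`, `P_i = M - N v^i`. The last equation says that the symbols
`Γ^i_{ij}`, `i ≠ j`, of the new metric are `(P_j / P_i) (Γ^i_{ij} - z^i ∂_j N / F)`. -/
structure RecData (U : Set (Fin n → ℝ)) (g z : Fin n → (Fin n → ℝ) → ℝ) (N F : (Fin n → ℝ) → ℝ)
    (P : Fin n → (Fin n → ℝ) → ℝ) : Prop where
  metric : IsMetric U g
  triple : ∀ u ∈ U, ∀ i j k, i ≠ j → i ≠ k → j ≠ k → tripleCurv g i j k u = 0
  affinor : IsAffinor U g z
  smoothN : ContDiffOn ℝ ∞ N U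
  smoothF : ContDiffOn ℝ ∞ F U
  smoothP : ∀ i, ContDiffOn ℝ ∞ (P i) U
  F_ne : ∀ u ∈ U, F u ≠ 0
  P_ne : ∀ u ∈ U, ∀ i, P i u ≠ 0
  diag : IsDiagHess U g N
  pdF : ∀ u ∈ U, ∀ j, pd j F u = z j u * pd j N u
  pdP : ∀ u ∈ U, ∀ i j, i ≠ j → pd j (P i) u
    = (P j u - P i u) * gam g i j u + (z j u * P i u - z i u * P j u) * pd j N u / F u

/-- The affinor `w^i = z^i |∇N|² / (2 F²) - ∇^i ∇_i N / F`. -/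
noncomputable def recAffinor (g z : Fin n → (Fin n → ℝ) → ℝ) (N F : (Fin n → ℝ) → ℝ) (i : Fin n)
    (u : Fin n → ℝ) : ℝ :=
  z i u * gradSq g N u / (2 * F u ^ 2) - hess g N i i u / F u

variable (D : RecData U g z N F P)
include D

theorem RecData.contDiffOn_recAffinor (hU : IsOpen U) (i : Fin n) :
    ContDiffOn ℝ ∞ (recAffinor g z N F i) U :=
  (((D.affinor.1 i).mul (contDiffOn_gradSq hU D.metric D.smoothN)).div
    (contDiffOn_const.mul (D.smoothF.pow 2))
    fun u hu => mul_ne_zero two_ne_zero (pow_ne_zero 2 (D.F_ne u hu))).sub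
    ((contDiffOn_hess_self hU D.metric D.smoothN i).div D.smoothF D.F_ne)

theorem RecData.gam_eq (hU : IsOpen U) (hu : u ∈ U) (i j : Fin n) :
    gam (fun i u => (P i u / F u) ^ 2 * g i u) i j u
      = gam g i j u + pd j (P i) u / P i u - z j u * pd j N u / F u := by
  have hF := D.F_ne u hu
  have hP := D.P_ne u hu i
  have h0 := (D.metric i).2 u hu
  have h := ((((hasPd hU hu (D.smoothP i) j).div (hasPd hU hu D.smoothF j) hF).sq).mul
    (hasPd hU hu (D.metric i).1 j)).eq
  rw [gam, h, D.metric.pd_eq hu, D.pdF u hu]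
  field_simp
  ring

theorem RecData.gam_of_ne (hU : IsOpen U) (hu : u ∈ U) (hij : i ≠ j) :
    gam (fun i u => (P i u / F u) ^ 2 * g i u) i j u
      = P j u / P i u * (gam g i j u - z i u * pd j N u / F u) := by
  have hF := D.F_ne u hu
  have hP := D.P_ne u hu i
  rw [D.gam_eq hU hu, D.pdP u hu i j hij]
  field_simp
  ring

/-- The first two terms of the sectional curvature of the reciprocal metric. -/
theorem RecData.sect_term (hU : IsOpen U) (hu : u ∈ U) (hij : i ≠ j) :
    (pd j (gam (fun i u => (P i u / F u) ^ 2 * g i u) i j) u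
      + gam (fun i u => (P i u / F u) ^ 2 * g i u) i j u ^ 2
      - gam (fun i u => (P i u / F u) ^ 2 * g i u) i j u
        * gam (fun i u => (P i u / F u) ^ 2 * g i u) j j u) / ((P j u / F u) ^ 2 * g j u)
      = F u ^ 2 / (P i u * P j u) * ((pd j (gam g i j) u
        - (gam g i j u * (z j u - z i u) * pd j N u + z i u * pd j (pd j N) u) / F u
        + z i u * z j u * pd j N u ^ 2 / F u ^ 2
        + (gam g i j u - z i u * pd j N u / F u) * (gam g i j u - gam g j j u)) / g j u) := by
  have hF := D.F_ne u hu
  have hPi := D.P_ne u hu i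
  have hPj := D.P_ne u hu j
  have h0 := (D.metric j).2 u hu
  have hN1 := contDiffOn_pd hU D.smoothN
  have hd := HasPd.congr hU hu (fun x hx => (D.gam_of_ne hU hx hij).symm)
    (((hasPd hU hu (D.smoothP j) j).div (hasPd hU hu (D.smoothP i) j) hPi).mul
      ((hasPd hU hu (D.metric.contDiffOn_gam hU i j) j).sub
        (((hasPd hU hu (D.affinor.1 i) j).mul (hasPd hU hu (hN1 j) j)).div
          (hasPd hU hu D.smoothF j) hF)))
  rw [hd.eq, D.gam_of_ne hU hu hij, D.gam_eq hU hu j j, D.pdF u hu, D.affinor.2 u hu i j hij,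
    christoffel_left, D.pdP u hu i j hij]
  field_simp
  ring

/-- The reciprocal metric has sectional curvatures proportional to
`R^{ij}_{ij} - w^i z^j - w^j z^i`. -/
theorem RecData.sect_eq (hU : IsOpen U)
    (hflat : IsFlat U (fun i u => (P i u / F u) ^ 2 * g i u)) (hu : u ∈ U) (hij : i ≠ j) :
    sect g i j u = recAffinor g z N F i u * z j u + recAffinor g z N F j u * z i u := by
  have hF := D.F_ne u hu
  have hPi := D.P_ne u hu i
  have hPj := D.P_ne u hu j
  have h0 (r : Fin n) := (D.metric r).2 u hu
  have hi := h0 i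
  have hj := h0 j
  have h := hflat.sect_eq_zero hU hu hij
  rw [sect, D.sect_term hU hu hij, D.sect_term hU hu hij.symm] at h
  have hsum : ∑ s ∈ ({i, j} : Finset (Fin n))ᶜ,
      gam (fun i u => (P i u / F u) ^ 2 * g i u) i s u
        * gam (fun i u => (P i u / F u) ^ 2 * g i u) j s u / ((P s u / F u) ^ 2 * g s u)
      = F u ^ 2 / (P i u * P j u) * (∑ s ∈ ({i, j} : Finset (Fin n))ᶜ,
          gam g i s u * gam g j s u / g s u
        - z j u / F u * ∑ s ∈ ({i, j} : Finset (Fin n))ᶜ, gam g i s u * pd s N u / g s u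
        - z i u / F u * ∑ s ∈ ({i, j} : Finset (Fin n))ᶜ, gam g j s u * pd s N u / g s u
        + z i u * z j u / F u ^ 2 * ∑ s ∈ ({i, j} : Finset (Fin n))ᶜ, pd s N u ^ 2 / g s u) := by
    simp only [Finset.mul_sum, ← Finset.sum_sub_distrib, ← Finset.sum_add_distrib]
    refine Finset.sum_congr rfl fun s hs => ?_
    simp only [Finset.mem_compl, Finset.mem_insert, Finset.mem_singleton, not_or] at hs
    have hs0 := h0 s
    have hPs := D.P_ne u hu s
    rw [D.gam_of_ne hU hu (Ne.symm hs.1), D.gam_of_ne hU hu (Ne.symm hs.2)]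
    field_simp
    ring
  rw [hsum] at h
  have hc : F u ^ 2 / (P i u * P j u) ≠ 0 := by positivity
  rw [mul_comm (P j u) (P i u), ← mul_neg, ← mul_sub, ← mul_sub] at h
  have h' := (mul_eq_zero.1 h).resolve_left hc
  rw [sect, recAffinor, recAffinor, gradSq, sum_eq_add_add_sum_compl hij, hess_self D.metric hu,
    hess_self D.metric hu, sum_compl_singleton_eq hij, sum_compl_singleton_eq hij.symm,
    Finset.pair_comm j i]
  rw [← sub_eq_zero, ← h']
  field_simp
  ring

theorem RecData.isAffinor (hU : IsOpen U)
    (hflat : IsFlat U (fun i u => (P i u / F u) ^ 2 * g i u)) :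
    IsAffinor U g (recAffinor g z N F) := by
  refine ⟨D.contDiffOn_recAffinor hU, fun u hu i j hij => ?_⟩
  have hF := D.F_ne u hu
  have hQ := hasPd_gradSq hU D.metric D.smoothN D.diag hu j
  have hh := hasPd_hess_self hU D.metric D.smoothN D.diag hu (D.triple u hu) hij
  have hFd := hasPd hU hu D.smoothF j
  have h := ((((hasPd hU hu (D.affinor.1 i) j).mul hQ).div (hFd.sq.const_mul 2)
    (mul_ne_zero two_ne_zero (pow_ne_zero 2 hF))).sub (hh.div hFd hF)).eq
  refine Eq.trans h ?_
  rw [D.sect_eq hU hflat hu hij, D.pdF u hu, D.affinor.2 u hu i j hij, christoffel_left]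
  simp only [recAffinor]
  field_simp
  ring

theorem RecData.isHamiltonian (hU : IsOpen U)
    (hflat : IsFlat U (fun i u => (P i u / F u) ^ 2 * g i u)) :
    (pairOp g (recAffinor g z N F) z).IsHamiltonian U := by
  refine ⟨D.metric, ?_, ?_, fun u hu i j k l => ?_⟩
  · ext a b
    fin_cases a <;> fin_cases b <;> rfl
  · intro p
    fin_cases p
    · exact D.isAffinor hU hflat
    · exact D.affinor
  · simp only [pairOp]
    rw [riemannUp_eq_sect D.metric hU hu (D.triple u hu)]
    by_cases hij : i = j
    · subst hij
      by_cases h : i = k ∧ i = l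
      · simp [h]
      · have h' : ¬(i = l ∧ i = k) := fun h' => h h'.symm
        simp [h, h']
    · rw [D.sect_eq hU hflat hu hij]
      simp [Fin.sum_univ_two]
      left
      ring

/-- The potential `-|∇N|² / (2 F)` of the one-form `∑ w^j ∂_j N du^j`. -/
theorem RecData.hasPd_potential (hU : IsOpen U) (hu : u ∈ U) (j : Fin n) :
    HasPd j (fun u => -(gradSq g N u / (2 * F u))) (recAffinor g z N F j u * pd j N u) u := by
  have hF := D.F_ne u hu
  refine ((hasPd_gradSq hU D.metric D.smoothN D.diag hu j).div
    ((hasPd hU hu D.smoothF j).const_mul 2) (mul_ne_zero two_ne_zero hF)).neg.congr_val ?_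
  rw [D.pdF u hu, recAffinor]
  field_simp
  ring

theorem RecData.contDiffOn_potential (hU : IsOpen U) :
    ContDiffOn ℝ ∞ (fun u => -(gradSq g N u / (2 * F u))) U :=
  ((contDiffOn_gradSq hU D.metric D.smoothN).div (contDiffOn_const.mul D.smoothF)
    fun u hu => mul_ne_zero two_ne_zero (D.F_ne u hu)).neg

/-- With the nonlocal terms `-|∇N|² / (2 F)` and `F`, the density `N` is a Casimir. -/
theorem RecData.generates_zero (hU : IsOpen U) {w : Fin n → (Fin n → ℝ) → ℝ}
    (hw : ∀ u ∈ U, ∀ i, w i u = recAffinor g z N F i u) :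
    (pairOp g w z).Generates U N (fun _ _ => 0) := by
  refine ⟨![fun u => -(gradSq g N u / (2 * F u)), F], ?_, ?_, fun u hu i k => ?_⟩
  · intro q
    fin_cases q
    · exact D.contDiffOn_potential hU
    · exact D.smoothF
  · intro q u hu j
    fin_cases q
    · change pd j (fun u => -(gradSq g N u / (2 * F u))) u = w j u * pd j N u
      rw [(D.hasPd_potential hU hu j).eq, hw u hu]
    · exact D.pdF u hu j
  · by_cases hik : i = k
    · subst hik
      have hF := D.F_ne u hu
      simp only [pairOp, Fin.sum_univ_two]
      simp [hw u hu, recAffinor]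
      field_simp
      ring
    · simp [hik, pairOp, D.diag.hess_of_ne hu hik]

end Reciprocal

/-! ### Uniqueness of the affinor -/

section Uniqueness

variable {n : ℕ} {U : Set (Fin n → ℝ)} {g z w w' d v : Fin n → (Fin n → ℝ) → ℝ}
  {i j k : Fin n} {u : Fin n → ℝ}

theorem IsAffinor.sub (hU : IsOpen U) (hw : IsAffinor U g w) (hw' : IsAffinor U g w') :
    IsAffinor U g (fun i u => w i u - w' i u) := by
  refine ⟨fun i => (hw.1 i).sub (hw'.1 i), fun u hu i j hij => ?_⟩
  rw [((hasPd hU hu (hw.1 i) j).sub (hasPd hU hu (hw'.1 i) j)).eq, hw.2 u hu i j hij,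
    hw'.2 u hu i j hij]
  ring

theorem isAffinor_const (c : ℝ) : IsAffinor U g (fun _ _ => c) :=
  ⟨fun _ => contDiffOn_const, fun u hu i j hij => by rw [(hasPd_const c).eq]; ring⟩

/-- The symmetric product with `z` is injective on affinors: an affinor `d` with
`d^i z^j + d^j z^i = 0` for `i ≠ j` vanishes. -/
def IsCancellable (U : Set (Fin n → ℝ)) (g z : Fin n → (Fin n → ℝ) → ℝ) : Prop :=
  ∀ d, IsAffinor U g d → (∀ u ∈ U, ∀ i j, i ≠ j → d i u * z j u + d j u * z i u = 0) →
    ∀ u ∈ U, ∀ i, d i u = 0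

theorem exists_distinct (hn : 3 ≤ n) (j : Fin n) : ∃ i k : Fin n, i ≠ j ∧ k ≠ j ∧ i ≠ k := by
  have h : 1 < (({j} : Finset (Fin n))ᶜ).card := by
    rw [Finset.card_compl, Fintype.card_fin, Finset.card_singleton]
    omega
  obtain ⟨i, hi, k, hk, hik⟩ := Finset.one_lt_card.1 h
  exact ⟨i, k, by simpa using hi, by simpa using hk, hik⟩

theorem triple_product_eq_zero (h : ∀ i j, i ≠ j → d i u * z j u + d j u * z i u = 0)
    (hij : i ≠ j) (hik : i ≠ k) (hjk : j ≠ k) : d j u * z i u * z k u = 0 := by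
  linear_combination (z k u * h i j hij - z j u * h i k hik + z i u * h j k hjk) / 2

theorem isCancellable_one (hn : 3 ≤ n) : IsCancellable U g (fun _ _ => 1) := by
  intro d _ h u hu j
  obtain ⟨i, k, hij, hkj, hik⟩ := exists_distinct hn j
  simpa using triple_product_eq_zero (z := fun _ _ => 1) (h u hu) hij hik hkj.symm

/-- The products `d^j v^j g_{jj}` depend on `u^j` only. -/
theorem hasPd_mul_mul (hU : IsOpen U) (hg : IsMetric U g) (hv : IsAffinor U g v)
    (hd : IsAffinor U g d) (h : ∀ u ∈ U, ∀ i j, i ≠ j → d i u * v j u + d j u * v i u = 0)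
    (hu : u ∈ U) (hij : i ≠ j) : HasPd i (fun u => d j u * v j u * g j u) 0 u := by
  refine (((hasPd hU hu (hd.1 j) i).mul (hasPd hU hu (hv.1 j) i)).mul
    (hasPd hU hu (hg j).1 i)).congr_val ?_
  rw [hd.2 u hu j i hij.symm, hv.2 u hu j i hij.symm, hg.pd_eq hu, christoffel_left]
  linear_combination (gam g j i u * g j u) * h u hu i j hij

/-- The set where `v^i = 0` and `d^j ≠ 0` is open because `d^j v^i v^k = 0`, and closed because
`d^j v^j g_{jj}` and `d^k v^k g_{kk}` are constant along all coordinate lines but one. -/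
theorem eq_zero_of_pairing_eq_zero (hU : IsOpen U) (hUc : IsConnected U) (hg : IsMetric U g)
    (hs : IsStrictlyHyperbolic U v) (hv : IsAffinor U g v) (hd : IsAffinor U g d)
    (h : ∀ u ∈ U, ∀ i j, i ≠ j → d i u * v j u + d j u * v i u = 0)
    (hij : i ≠ j) (hik : i ≠ k) (hjk : j ≠ k) {q : Fin n → ℝ} (hq : q ∈ U) (hvq : v i q = 0)
    (hdq : d j q ≠ 0) : ∀ u ∈ U, v i u = 0 := by
  have hcv (a : Fin n) {x} (hx : x ∈ U) : ContinuousAt (v a) x :=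
    (hs.1 a).continuousOn.continuousAt (hU.mem_nhds hx)
  have hcd (a : Fin n) {x} (hx : x ∈ U) : ContinuousAt (d a) x :=
    (hd.1 a).continuousOn.continuousAt (hU.mem_nhds hx)
  have hne {x} (hx : x ∈ U) (hvx : v i x = 0) : v j x ≠ 0 ∧ v k x ≠ 0 :=
    ⟨hvx ▸ hs.2 x hx j i hij.symm, hvx ▸ hs.2 x hx k i hik.symm⟩
  have hsub : U ⊆ {x | x ∈ U ∧ v i x = 0 ∧ d j x ≠ 0} := by
    refine hUc.isPreconnected.subset_of_closure_inter_subset ?_ ⟨q, hq, hq, hvq, hdq⟩ ?_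
    · rw [isOpen_iff_mem_nhds]
      rintro x ⟨hx, hvx, hdx⟩
      filter_upwards [hU.mem_nhds hx, (hcd j hx).eventually_ne hdx,
        (hcv k hx).eventually_ne (hne hx hvx).2] with y hy hdy hvy
      refine ⟨hy, ?_, hdy⟩
      have := triple_product_eq_zero (h y hy) hij hik hjk
      simpa [hdy, hvy] using this
    · rintro p ⟨hpc, hp⟩
      have hvp : v i p = 0 := by
        by_contra hvp
        obtain ⟨x, hx, hxO⟩ := mem_closure_iff_nhds.1 hpc _ ((hcv i hp).eventually_ne hvp)
        exact hx hxO.2.1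
      have hev : ∀ᶠ y in nhds p, y ∈ U ∧ v j y ≠ 0 ∧ v k y ≠ 0 := by
        filter_upwards [hU.mem_nhds hp, (hcv j hp).eventually_ne (hne hp hvp).1,
          (hcv k hp).eventually_ne (hne hp hvp).2] with y h1 h2 h3 using ⟨h1, h2, h3⟩
      obtain ⟨r, hr, hball⟩ := Metric.eventually_nhds_iff_ball.1 hev
      obtain ⟨x, hxb, hxO⟩ := mem_closure_iff_nhds.1 hpc _ (Metric.ball_mem_nhds p hr)
      have hE (a : Fin n) : ∀ u ∈ Metric.ball p r, ∀ b,
          DifferentiableAt ℝ (fun u => d a u * v a u * g a u) u ∧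
            (b ≠ a → pd b (fun u => d a u * v a u * g a u) u = 0) := fun u hu b =>
        ⟨(((hasPd hU (hball u hu).1 (hd.1 a) b).mul (hasPd hU (hball u hu).1 (hv.1 a) b)).mul
          (hasPd hU (hball u hu).1 (hg a).1 b)).diff,
          fun hba => (hasPd_mul_mul hU hg hv hd h (hball u hu).1 hba).eq⟩
      -- From `x` to `p` in two steps: first all coordinates but the `j`-th move, then the `j`-th.
      have hyb : Function.update p j (x j) ∈ Metric.ball p r := by
        rw [Metric.mem_ball, dist_pi_lt_iff hr] at hxb ⊢
        intro b
        by_cases hb : b = j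
        · subst hb; simpa using hxb b
        · simpa [hb] using hr
      have e1 := eq_of_pd_eq_zero_of_ne (hE j) hxb hyb (by simp)
      have e2 := eq_of_pd_eq_zero_of_ne (hE k) hyb (Metric.mem_ball_self hr) (by simp [hjk.symm])
      obtain ⟨hyU, hyj, hyk⟩ := hball _ hyb
      have hswap {y} (hy : y ∈ U) (hyj : v j y ≠ 0) (hyk : v k y ≠ 0) :
          d j y = 0 ↔ d k y = 0 := by
        have h' := h y hy j k hjk
        constructor <;> intro h0 <;> simpa [h0, hyj, hyk] using h'
      have hzero (a : Fin n) {y} (hy : y ∈ U) (hya : v a y ≠ 0) :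
          d a y * v a y * g a y = 0 ↔ d a y = 0 := by
        simp [hya, (hg a).2 y hy]
      refine ⟨hp, hvp, fun hdp => ?_⟩
      have hdkp := (hswap hp (hne hp hvp).1 (hne hp hvp).2).1 hdp
      have hky := (hzero k hyU hyk).1 (e2.trans ((hzero k hp (hne hp hvp).2).2 hdkp))
      have hjy := (hswap hyU hyj hyk).2 hky
      exact hxO.2.2 ((hzero j hxO.1 (hball x hxb).2.1).1 (e1.trans ((hzero j hyU hyj).2 hjy)))
  exact fun u hu => (hsub hu).2.1

theorem isCancellable_of_isStrictlyHyperbolic (hn : 3 ≤ n) (hU : IsOpen U) (hUc : IsConnected U)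
    (hg : IsMetric U g) (hs : IsStrictlyHyperbolic U v) (hv : IsAffinor U g v)
    (h3 : n = 3 → ∀ i, ∃ u ∈ U, v i u ≠ 0) : IsCancellable U g v := by
  intro d hd h q hq j
  by_contra hdq
  obtain ⟨i, k, hij, hkj, hik, hvq⟩ : ∃ i k : Fin n, i ≠ j ∧ k ≠ j ∧ i ≠ k ∧ v i q = 0 := by
    obtain ⟨i, k, hij, hkj, hik⟩ := exists_distinct hn j
    have := triple_product_eq_zero (h q hq) hij hik hkj.symm
    rw [mul_assoc, mul_eq_zero, or_iff_right hdq, mul_eq_zero] at this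
    rcases this with h0 | h0
    · exact ⟨i, k, hij, hkj, hik, h0⟩
    · exact ⟨k, i, hkj, hij, hik.symm, h0⟩
  by_cases hl : ∃ l, l ≠ i ∧ l ≠ j ∧ l ≠ k
  · -- A fourth index gives `d^j v^k v^l = 0`, while only `v^i` can vanish at `q`.
    obtain ⟨l, hli, hlj, hlk⟩ := hl
    have hk : v k q ≠ 0 := hvq ▸ hs.2 q hq k i hik.symm
    have hl : v l q ≠ 0 := hvq ▸ hs.2 q hq l i hli
    have := triple_product_eq_zero (h q hq) hkj hlk.symm hlj.symm
    simp [hdq, hk, hl] at this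
  · have hn3 : n = 3 := by
      refine le_antisymm ?_ hn
      have hsub : (Finset.univ : Finset (Fin n)) ⊆ {i, j, k} := fun l _ => by
        by_contra hc
        simp only [Finset.mem_insert, Finset.mem_singleton, not_or] at hc
        exact hl ⟨l, hc⟩
      have := (Finset.card_le_card hsub).trans Finset.card_le_three
      simpa using this
    obtain ⟨u, hu, hvu⟩ := h3 hn3 i
    exact hvu (eq_zero_of_pairing_eq_zero hU hUc hg hs hv hd h hij hik hkj.symm hq hvq hdq u hu)

theorem pairOp_curvature (h : (pairOp g w z).IsHamiltonian U) (hu : u ∈ U) (hij : i ≠ j) :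
    riemannUp g i j i j u = w i u * z j u + w j u * z i u := by
  have := h.2.2.2 u hu i j i j
  simp only [pairOp] at this
  rw [this]
  simp [Fin.sum_univ_two, hij]
  ring

/-- An affinor is determined by its symmetric products with a cancellable one. -/
theorem IsCancellable.eq (hz : IsCancellable U g z) (hU : IsOpen U) (hw : IsAffinor U g w)
    (hw' : IsAffinor U g w')
    (h : ∀ u ∈ U, ∀ i j, i ≠ j → w i u * z j u + w j u * z i u
      = w' i u * z j u + w' j u * z i u) (hu : u ∈ U) (i : Fin n) : w i u = w' i u := by
  refine sub_eq_zero.1 (hz _ (hw.sub hU hw') (fun u hu i j hij => ?_) u hu i)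
  linear_combination h u hu i j hij

end Uniqueness

/-! ### Combinations of densities -/

section Densities

variable {n m : ℕ} {U : Set (Fin n → ℝ)} {g z w v : Fin n → (Fin n → ℝ) → ℝ} {J : HamOp n m}
  {N A F : (Fin n → ℝ) → ℝ} {P ξ : Fin n → (Fin n → ℝ) → ℝ} {u : Fin n → ℝ}

theorem pd_const_mul (hU : IsOpen U) (hu : u ∈ U) (hN : ContDiffOn ℝ ∞ N U) (c : ℝ) (i : Fin n) :
    pd i (fun x => c * N x) u = c * pd i N u :=
  ((hasPd hU hu hN i).const_mul c).eq

theorem hess_const_mul (hU : IsOpen U) (hu : u ∈ U) (hN : ContDiffOn ℝ ∞ N U) (c : ℝ)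
    (i k : Fin n) : hess g (fun x => c * N x) i k u = c * hess g N i k u := by
  have h2 (s k : Fin n) : pd s (pd k (fun x => c * N x)) u = c * pd s (pd k N) u := by
    rw [pd_congr hU hu fun x hx => pd_const_mul hU hx hN c k,
      pd_const_mul hU hu (contDiffOn_pd hU hN k)]
  simp only [hess, h2, pd_const_mul hU hu hN, Finset.mul_sum, mul_sub]
  refine Finset.sum_congr rfl fun s _ => ?_
  congr 1
  · ring
  · exact Finset.sum_congr rfl fun r _ => by ring

theorem HamOp.Generates.const_mul (hU : IsOpen U) (hN : ContDiffOn ℝ ∞ N U)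
    (h : J.Generates U N ξ) (c : ℝ) :
    J.Generates U (fun u => c * N u) (fun i u => c * ξ i u) := by
  obtain ⟨T, hT, hTd, hV⟩ := h
  refine ⟨fun q u => c * T q u, fun q => contDiffOn_const.mul (hT q), fun q u hu j => ?_,
    fun u hu i k => ?_⟩
  · rw [pd_const_mul hU hu (hT q), pd_const_mul hU hu hN, hTd q u hu]
    ring
  · have := congrArg (c * ·) (hV u hu i k)
    simp only [mul_add, mul_ite, mul_zero, Finset.mul_sum] at this
    rw [hess_const_mul hU hu hN, ← this]
    congr 2
    exact Finset.sum_congr rfl fun p _ => Finset.sum_congr rfl fun q _ => by ring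

theorem IsConservationLaw.const_mul (hU : IsOpen U) (h : IsConservationLaw U v N A) (c : ℝ) :
    IsConservationLaw U v (fun u => c * N u) (fun u => c * A u) := by
  refine ⟨contDiffOn_const.mul h.1, contDiffOn_const.mul h.2.1, fun u hu i => ?_⟩
  rw [pd_const_mul hU hu h.1, pd_const_mul hU hu h.2.1, h.2.2 u hu]
  ring

theorem isCombination_of_generates (hU : IsOpen U) (hN : IsConservationLaw U v N A) (s : ℝ)
    (h : J.Generates U N (fun i u => s * z i u)) :
    IsCombination (casimirs U v J ∪ {h | IsDensityOf U v J z h}) N := by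
  refine ⟨0, ?_⟩
  simp only [add_zero]
  by_cases hs : s = 0
  · exact Submodule.subset_span (Or.inl ⟨⟨A, hN⟩, by simpa [hs] using h⟩)
  · have h1 : (fun u => s⁻¹ * N u) ∈ {h | IsDensityOf U v J z h} := by
      refine ⟨⟨_, hN.const_mul hU s⁻¹⟩, ?_⟩
      simpa [inv_mul_cancel_left₀ hs] using h.const_mul hU hN.1 s⁻¹
    have h2 : N = s • fun u => s⁻¹ * N u := by
      ext u
      simp [mul_inv_cancel_left₀ hs]
    rw [h2]
    exact Submodule.smul_mem _ _ (Submodule.subset_span (Or.inr h1))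

theorem RecData.exists_affinor (D : RecData U g z N F P) (hU : IsOpen U)
    (hflat : IsFlat U (fun i u => (P i u / F u) ^ 2 * g i u)) :
    ∃ w : Fin n → (Fin n → ℝ) → ℝ, IsAffinor U g w ∧
      (∀ u ∈ U, ∀ i j, i ≠ j → riemannUp g i j i j u = w i u * z j u + w j u * z i u) ∧
      (pairOp g w z).IsHamiltonian U :=
  ⟨_, D.isAffinor hU hflat, fun _ hu _ _ hij => pairOp_curvature (D.isHamiltonian hU hflat) hu hij,
    D.isHamiltonian hU hflat⟩

theorem RecData.isCombination_pairOp (D : RecData U g z N F P) (hU : IsOpen U)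
    (hflat : IsFlat U (fun i u => (P i u / F u) ^ 2 * g i u)) (hz : IsCancellable U g z)
    (hN : IsConservationLaw U v N A) (hw : (pairOp g w z).IsHamiltonian U) :
    IsCombination (casimirs U v (pairOp g w z) ∪ {h | IsDensityOf U v (pairOp g w z) z h}) N := by
  refine isCombination_of_generates hU hN 0 ?_
  simp only [zero_mul]
  refine D.generates_zero hU fun u hu i => hz.eq hU (hw.2.2.1 0) (D.isAffinor hU hflat)
    (fun u hu i j hij => ?_) hu i
  exact (pairOp_curvature hw hu hij).symm.trans (pairOp_curvature (D.isHamiltonian hU hflat) hu hij)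

/-- For flat `g` the affinor vanishes, so the potential `-|∇N|² / (2 F)` is a constant and `∇∇N` is
a constant multiple of `z`. -/
theorem RecData.isCombination_localOp (D : RecData U g z N F P) (hU : IsOpen U)
    (hUc : IsConnected U) (hflat : IsFlat U (fun i u => (P i u / F u) ^ 2 * g i u))
    (hz : IsCancellable U g z) (hN : IsConservationLaw U v N A) (hg : IsFlat U g) :
    IsCombination (casimirs U v (localOp g) ∪ {h | IsDensityOf U v (localOp g) z h}) N := by
  have hw (u) (hu : u ∈ U) (i : Fin n) : recAffinor g z N F i u = 0 :=
    hz.eq (w' := fun _ _ => 0) hU (D.isAffinor hU hflat) (isAffinor_const 0)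
      (fun u hu i j hij => by
        rw [← D.sect_eq hU hflat hu hij, hg.sect_eq_zero hU hu hij]; ring) hu i
  obtain ⟨s, hs⟩ := exists_const_of_pd_eq_zero hU hUc fun u hu j =>
    (D.hasPd_potential hU hu j).congr_val (by rw [hw u hu, zero_mul])
  refine isCombination_of_generates hU hN (-s) ⟨fun _ _ => 0, fun q => q.elim0, fun q => q.elim0,
    fun u hu i k => ?_⟩
  by_cases hik : i = k
  · subst hik
    have hF := D.F_ne u hu
    have h1 := hw u hu i
    have h2 := hs u hu
    rw [recAffinor] at h1
    simp only [localOp, if_true, Finset.univ_eq_empty, Finset.sum_empty, add_zero]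
    rw [← h2]
    field_simp at h1 ⊢
    linarith
  · simp [hik, localOp, D.diag.hess_of_ne hu hik]

/-- In constant curvature `K` the affinor is `K / 2`. -/
theorem RecData.isCombination_constOp (D : RecData U g (fun _ _ => 1) N N P) (hn : 3 ≤ n)
    (hU : IsOpen U) (hUc : IsConnected U)
    (hflat : IsFlat U (fun i u => (P i u / N u) ^ 2 * g i u))
    (hN : IsConservationLaw U v N A) {K : ℝ} (hg : HasConstCurvature U g K) :
    IsCombination (casimirs U v (constOp g K) ∪ momenta U v (constOp g K)) N := by
  have hw (u) (hu : u ∈ U) (i : Fin n) : recAffinor g (fun _ _ => 1) N N i u = K / 2 :=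
    (isCancellable_one hn).eq (w' := fun _ _ => K / 2) hU (D.isAffinor hU hflat)
      (isAffinor_const _) (fun u hu i j hij => by
        rw [← D.sect_eq hU hflat hu hij, ← riemannUp_sect D.metric hU hu hij, hg.2 u hu]
        simp [hij]) hu i
  obtain ⟨s, hs⟩ := exists_const_of_pd_eq_zero hU hUc fun u hu j =>
    ((D.hasPd_potential hU hu j).sub ((hasPd hU hu D.smoothN j).const_mul (K / 2))).congr_val
      (by rw [hw u hu, sub_self])
  refine isCombination_of_generates hU hN (-s) ⟨fun _ => N, fun _ => D.smoothN,
    fun q u hu j => by simp [constOp], fun u hu i k => ?_⟩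
  by_cases hik : i = k
  · subst hik
    have hF := D.F_ne u hu
    have h1 := hw u hu i
    have h2 := hs u hu
    rw [recAffinor] at h1
    simp only [constOp, if_true, Finset.univ_unique, Finset.sum_singleton]
    rw [← h2]
    field_simp at h1 ⊢
    linarith
  · simp [hik, constOp, D.diag.hess_of_ne hu hik]

end Densities

/-! ### Metrics of the system -/

section MetricOf

variable {n : ℕ} {U : Set (Fin n → ℝ)} {g v : Fin n → (Fin n → ℝ) → ℝ} {i j k : Fin n}
  {u : Fin n → ℝ}

theorem pd_apply_coord {f : ℝ → ℝ} (hij : i ≠ j)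
    (hf : DifferentiableAt ℝ (fun u : Fin n → ℝ => f (u i)) u) :
    pd j (fun u : Fin n → ℝ => f (u i)) u = 0 := by
  rw [pd, ← hf.lineDeriv_eq_fderiv, lineDeriv]
  simp [hij]

theorem gam_mul_coord (hU : IsOpen U) (hg : IsMetric U g) {f : Fin n → ℝ → ℝ}
    (hf : ∀ i, ContDiffOn ℝ ∞ (fun u : Fin n → ℝ => f i (u i)) U ∧ ∀ u ∈ U, f i (u i) ≠ 0)
    (hu : u ∈ U) (hij : i ≠ j) : gam (fun i u => f i (u i) * g i u) i j u = gam g i j u := by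
  have h1 := hasPd hU hu (hf i).1 j
  have h2 := (hf i).2 u hu
  have h3 := (hg i).2 u hu
  rw [gam, (h1.mul (hasPd hU hu (hg i).1 j)).eq, pd_apply_coord hij h1.diff, gam]
  field_simp
  ring

theorem IsMetricOf.tripleCurv_eq_zero (hU : IsOpen U) (h : IsMetricOf U v g) (hu : u ∈ U)
    (hij : i ≠ j) (hik : i ≠ k) (hjk : j ≠ k) : tripleCurv g i j k u = 0 := by
  obtain ⟨hg, f, hf, hDN⟩ := h
  rw [← hDN.1.tripleCurv_eq_zero hu hij hik hjk, tripleCurv, tripleCurv,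
    pd_congr hU hu fun x hx => gam_mul_coord hU hg hf hx hij, gam_mul_coord hU hg hf hu hij,
    gam_mul_coord hU hg hf hu hik, gam_mul_coord hU hg hf hu hjk,
    gam_mul_coord hU hg hf hu hjk.symm]

/-- The velocities `v^i = ∇^i ∇_i h` are affinors of the flat metric generating the system, hence
of every metric with the same symbols `Γ^i_{ij}`, `i ≠ j`. -/
theorem IsMetricOf.isAffinor (hU : IsOpen U) (hs : IsStrictlyHyperbolic U v)
    (h : IsMetricOf U v g) : IsAffinor U g v := by
  obtain ⟨hg, f, hf, hflat, H, hH, T, -, -, hgen⟩ := h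
  have hhess (u) (hu : u ∈ U) (i k : Fin n) :
      hess (fun i u => f i (u i) * g i u) H i k u = if i = k then v i u else 0 := by
    simpa [localOp] using hgen u hu i k
  have hd : IsDiagHess U (fun i u => f i (u i) * g i u) H := by
    intro u hu i j hij
    have h0 := hhess u hu i j
    rw [hess_of_ne hij, if_neg hij, div_eq_zero_iff,
      or_iff_left ((hflat.1 i).2 u hu)] at h0
    linarith
  have hvi (u) (hu : u ∈ U) (i : Fin n) : hess (fun i u => f i (u i) * g i u) H i i u = v i u := by
    simpa using hhess u hu i i
  refine ⟨hs.1, fun u hu i j hij => ?_⟩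
  have h1 := hasPd_hess_self hU hflat.1 hH hd hu
    (fun i j k hij hik hjk => hflat.tripleCurv_eq_zero hu hij hik hjk) hij
  rw [← pd_congr hU hu fun x hx => hvi x hx i, h1.eq, hflat.sect_eq_zero hU hu hij, hvi u hu,
    hvi u hu, gam_mul_coord hU hg hf hu hij, christoffel_left]
  ring

end MetricOf

/-! ### Transformations of `x` only and of `t` only -/

section Transformations

variable {n : ℕ} {U : Set (Fin n → ℝ)} {g v : Fin n → (Fin n → ℝ) → ℝ}
  {B A N M : (Fin n → ℝ) → ℝ}

theorem recMetric_space : recMetric v B A (fun _ => 0) (fun _ => 1) g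
    = fun i u => (1 / B u) ^ 2 * g i u := by
  ext i u
  simp [recMetric]

theorem recMetric_time : recMetric v (fun _ => 1) (fun _ => 0) N M g
    = fun i u => ((M u - N u * v i u) / M u) ^ 2 * g i u := by
  ext i u
  simp [recMetric]

theorem recData_space (hU : IsOpen U) (hs : IsStrictlyHyperbolic U v) (hg : IsMetricOf U v g)
    (h : IsReciprocal U v B A (fun _ => 0) (fun _ => 1)) :
    RecData U g (fun _ _ => 1) B B (fun _ _ => 1) where
  metric := hg.1
  triple _ hu _ _ _ hij hik hjk := hg.tripleCurv_eq_zero hU hu hij hik hjk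
  affinor := isAffinor_const 1
  smoothN := h.1.1
  smoothF := h.1.1
  smoothP _ := contDiffOn_const
  F_ne u hu := by simpa using h.2.2 u hu
  P_ne _ _ _ := one_ne_zero
  diag := isDiagHess_of_conservationLaw hU hs (hg.isAffinor hU hs) h.1
  pdF u _ j := (one_mul _).symm
  pdP u _ i j _ := by rw [(hasPd_const 1).eq]; ring

theorem recData_time (hU : IsOpen U) (hs : IsStrictlyHyperbolic U v) (hg : IsMetricOf U v g)
    (h : IsReciprocal U v (fun _ => 1) (fun _ => 0) N M)
    (hm : IsMetric U (fun i u => ((M u - N u * v i u) / M u) ^ 2 * g i u)) :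
    RecData U g v N M (fun i u => M u - N u * v i u) where
  metric := hg.1
  triple _ hu _ _ _ hij hik hjk := hg.tripleCurv_eq_zero hU hu hij hik hjk
  affinor := hg.isAffinor hU hs
  smoothN := h.2.1.1
  smoothF := h.2.1.2.1
  smoothP i := h.2.1.2.1.sub (h.2.1.1.mul (hs.1 i))
  F_ne u hu := by simpa using h.2.2 u hu
  P_ne u hu i h0 := (hm i).2 u hu (by simp [h0])
  diag := isDiagHess_of_conservationLaw hU hs (hg.isAffinor hU hs) h.2.1
  pdF := h.2.1.2.2
  pdP u hu i j hij := by
    have hM : M u ≠ 0 := by simpa using h.2.2 u hu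
    rw [((hasPd hU hu h.2.1.2.1 j).sub ((hasPd hU hu h.2.1.1 j).mul (hasPd hU hu (hs.1 i) j))).eq,
      h.2.1.2.2 u hu, (hg.isAffinor hU hs).2 u hu i j hij, christoffel_left]
    field_simp
    ring

end Transformations

end Hydro

theorem mainTheorem2 (n : ℕ) (hn : 3 ≤ n) (U : Set (Fin n → ℝ)) (hU : IsOpen U)
    (hUc : IsConnected U) (v g : Fin n → (Fin n → ℝ) → ℝ)
    (hv : Hydro.IsStrictlyHyperbolic U v) (hg : Hydro.IsMetricOf U v g) :
    (∀ B A : (Fin n → ℝ) → ℝ,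
      Hydro.IsReciprocal U v B A (fun _ => 0) (fun _ => 1) →
      Hydro.IsFlat U (Hydro.recMetric v B A (fun _ => 0) (fun _ => 1) g) →
        (Hydro.IsFlat U g ∨ (∃ K, Hydro.HasConstCurvature U g K) ∨
          Hydro.IsConformallyFlat U g) ∧
        (∃ w : Fin n → (Fin n → ℝ) → ℝ, Hydro.IsAffinor U g w ∧
          (∀ u ∈ U, ∀ i j, i ≠ j → Hydro.riemannUp g i j i j u = w i u + w j u) ∧
          (Hydro.pairOp g w (fun _ _ => 1)).IsHamiltonian U) ∧
        (∀ w : Fin n → (Fin n → ℝ) → ℝ,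
          (Hydro.pairOp g w (fun _ _ => 1)).IsHamiltonian U →
          Hydro.IsCombination
            (Hydro.casimirs U v (Hydro.pairOp g w (fun _ _ => 1)) ∪
              Hydro.momenta U v (Hydro.pairOp g w (fun _ _ => 1))) B) ∧
        (∀ K : ℝ, Hydro.HasConstCurvature U g K →
          Hydro.IsCombination
            (Hydro.casimirs U v (Hydro.constOp g K) ∪
              Hydro.momenta U v (Hydro.constOp g K)) B) ∧
        (Hydro.IsFlat U g →
          Hydro.IsCombination
            (Hydro.casimirs U v (Hydro.localOp g) ∪
              Hydro.momenta U v (Hydro.localOp g)) B)) ∧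
    (∀ N M : (Fin n → ℝ) → ℝ,
      Hydro.IsReciprocal U v (fun _ => 1) (fun _ => 0) N M →
      Hydro.IsFlat U (Hydro.recMetric v (fun _ => 1) (fun _ => 0) N M g) →
      (n = 3 → ∀ i, ∃ u ∈ U, v i u ≠ 0) →
        (∃ w : Fin n → (Fin n → ℝ) → ℝ, Hydro.IsAffinor U g w ∧
          (∀ u ∈ U, ∀ i j, i ≠ j →
            Hydro.riemannUp g i j i j u = w i u * v j u + w j u * v i u) ∧
          (Hydro.pairOp g w v).IsHamiltonian U) ∧
        (∀ w : Fin n → (Fin n → ℝ) → ℝ,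
          (Hydro.pairOp g w v).IsHamiltonian U →
          Hydro.IsCombination
            (Hydro.casimirs U v (Hydro.pairOp g w v) ∪
              Hydro.hamiltonians U v (Hydro.pairOp g w v)) N) ∧
        (Hydro.IsFlat U g →
          Hydro.IsCombination
            (Hydro.casimirs U v (Hydro.localOp g) ∪
              Hydro.hamiltonians U v (Hydro.localOp g)) N)) := by
  have hva := hg.isAffinor hU hv
  refine ⟨fun B A h hflat => ?_, fun N M h hflat h3 => ?_⟩
  · have D := Hydro.recData_space hU hv hg h
    rw [Hydro.recMetric_space] at hflat
    have hc := Hydro.isCancellable_one (U := U) (g := g) hn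
    -- The reciprocal metric is `B⁻² g`, so `g` is conformally flat in all cases.
    refine ⟨Or.inr (Or.inr ⟨hg.1, fun u => (1 / B u) ^ 2,
      (contDiffOn_const.div h.1.1 D.F_ne).pow 2, fun u hu => ?_, hflat⟩), ?_,
      fun w hw => D.isCombination_pairOp hU hflat hc h.1 hw,
      fun K hK => D.isCombination_constOp hn hU hUc hflat h.1 hK,
      fun hgf => D.isCombination_localOp hU hUc hflat hc h.1 hgf⟩
    · have := D.F_ne u hu
      positivity
    · simpa only [mul_one] using D.exists_affinor hU hflat
  · rw [Hydro.recMetric_time] at hflat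
    have D := Hydro.recData_time hU hv hg h hflat.1
    have hc := Hydro.isCancellable_of_isStrictlyHyperbolic hn hU hUc hg.1 hv hva h3
    exact ⟨D.exists_affinor hU hflat, fun w hw => D.isCombination_pairOp hU hflat hc h.2.1 hw,
      fun hgf => D.isCombination_localOp hU hUc hflat hc h.2.1 hgf⟩
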